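/- For positive integers $m,n$ let $$f_4(m,n)=\Big|\Big\{(a_1,a_2,a_3,a_4)\in\mathbb{Z}_{>0}^4 : a_1\le a_2\le a_3\le a_4,\ \frac mn=\frac1{a_1}+\frac1{a_2}+\frac1{a_3}+\frac1{a_4}\Big\}\Big|.$$ For every $\varepsilon>0$ and every $K>0$ there is a constant $C=C(\varepsilon,K)>0$ such that for all positive integers $m,n$ all of the following hold: 1. if $m\le K n^{50/289}$, then $f_4(m,n)\le C\,n^{\varepsilon}\,\dfrac{n^{3/2}}{m^{3/4}}$; 2. if $n^{50/289}\le K m$ and $m\le K n^{5/17}$, then $f_4(m,n)\le C\,n^{\varepsilon}\,\dfrac{n^{28/17}}{m^{8/5}}$; 3. if $n^{5/17}\le K m$ and $m\le K n^{1/3}$, then $f_4(m,n)\le C\,n^{\varepsilon}\left(\dfrac nm\right)^{5/3}$; 4. if $n^{1/3}\le K m$ and $m\le K n^{4/5}$, then $f_4(m,n)\le C\,n^{\varepsilon}\,\dfrac{n^{4/3}}{m^{2/3}}$; 5. if $n^{4/5}\le K m$ and $m\le K n$, then $f_4(m,n)\le C\,n^{\varepsilon}\,\dfrac{n^{8/5}}{m}$.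 That is, $f_4(m,n)$ is $\ll_\varepsilon$ the stated bound in each range of $m$, the ranges being described by $\ll$ with arbitrary fixed implied constants. -/

import Mathlib

/-- The `k`-tuples `a₁ ≤ ⋯ ≤ aₖ` of positive integers with `q = 1/a₁ + ⋯ + 1/aₖ`. -/
def unitFractionReps (k : ℕ) (q : ℚ) : Set (Fin k → ℕ) :=
  {a | (∀ i, 0 < a i) ∧ Monotone a ∧ q = ∑ i, 1 / (a i : ℚ)}

/-- The set of representations is always finite, so that its `Set.ncard` is its true
cardinality. -/
theorem unitFractionReps_finite (k : ℕ) (q : ℚ) : (unitFractionReps k q).Finite := by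
  induction k generalizing q with
  | zero => exact Set.toFinite _
  | succ k ih =>
    have hsub : unitFractionReps (k + 1) q ⊆
        ⋃ b ∈ Set.Iic ⌊((k : ℚ) + 1) / q⌋₊,
          (fun t : Fin k → ℕ => (Fin.cons b t : Fin (k + 1) → ℕ)) ''
            unitFractionReps k (q - 1 / (b : ℚ)) := by
      rintro a ⟨hpos, hmono, hsum⟩
      have h0 : (0 : ℚ) < a 0 := by exact_mod_cast hpos 0
      have hq : 0 < q := by
        rw [hsum]
        refine Finset.sum_pos (fun i _ => ?_) Finset.univ_nonempty
        have : (0 : ℚ) < a i := by exact_mod_cast hpos i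
        positivity
      have hle : q ≤ ((k : ℚ) + 1) * (1 / (a 0 : ℚ)) := by
        have h := Finset.sum_le_card_nsmul (Finset.univ : Finset (Fin (k + 1)))
          (fun i => 1 / (a i : ℚ)) (1 / (a 0 : ℚ)) (fun i _ => by
            have : (a 0 : ℚ) ≤ a i := by exact_mod_cast hmono (Fin.zero_le i)
            exact one_div_le_one_div_of_le h0 this)
        rw [hsum]
        simpa using h
      have hb : a 0 ≤ ⌊((k : ℚ) + 1) / q⌋₊ := by
        apply Nat.le_floor
        rw [le_div_iff₀ hq]
        rw [mul_one_div, le_div_iff₀ h0] at hle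
        linarith
      simp only [Set.mem_iUnion, Set.mem_image]
      refine ⟨a 0, hb, Fin.tail a, ⟨fun i => hpos _, ?_, ?_⟩, Fin.cons_self_tail a⟩
      · intro i j hij
        exact hmono (Fin.succ_le_succ_iff.mpr hij)
      · rw [hsum, Fin.sum_univ_succ]
        simp [Fin.tail]
    exact ((Set.finite_Iic _).biUnion fun b _ => (ih _).image _).subset hsub

/-- `f_k(m,n)`: the number of `(a₁, …, aₖ)` in positive integers with `a₁ ≤ ⋯ ≤ aₖ` and
`m / n = 1/a₁ + ⋯ + 1/aₖ`. -/
noncomputable def unitFractionCount (k m n : ℕ) : ℕ :=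
  (unitFractionReps k ((m : ℚ) / (n : ℚ))).ncard

/-! All five ranges follow from one bound (`exists_unitFractionCount_four_le`): up to n^ε, the count
is at most n^{7/5} m^{-7/5} + n^{6/5} m^{-3/5}. Exponents are then compared range by range. The only
comparison without slack is that of the second monomial with n^{8/5}/m, for m near n.

Three fractions, m/n in lowest terms: reducing each aᵢ/n gives m = Σ cᵢ/tᵢ with cᵢ ∣ n, so the
triple (c₁, c₂, c₃) takes n^ε values. Here t₁ = g y₂ y₃, t₂ = g y₁ y₃, t₃ = g y₁ y₂ and m g y₁ y₂ y₃
= Σ cᵢ yᵢ. Each of four integers determines the solution up to divisor choices: y₂ y₃; g y₃; g y₂ y₃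
less its minimal value; the quotient by m of (m g y₁ y₂ - c₃)/gcd(c₁, c₂). They cannot all be at
least Q once Q⁵ m⁴ > 36 n³ (`TripleParam.exists_lt`), so there are at most about n^ε (1 + n^{3/5}
m^{-4/5}) solutions.

Four fractions: the smallest denominator a lies in (n/m, 4n/m], and m/n - 1/a = e/N in lowest terms
with N ≤ 4n²/m. The three-fraction bound is summed over a. The numerators e are rarely small: ma - n
= de with d ∣ n², and d fixes e modulo m, so Σ e^{-4/5} is about 1 + n^{1/5}/m up to n^ε
(`sum_num_rpow_le`). -/

/-! ### Divisor bound and counting by divisor codes. -/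

/-- The number of divisors of `k` is `O(k ^ δ)`. -/
theorem exists_card_divisors_le_rpow {δ : ℝ} (hδ : 0 < δ) :
    ∃ C : ℝ, 1 ≤ C ∧ ∀ k : ℕ, k ≠ 0 → (k.divisors.card : ℝ) ≤ C * (k : ℝ) ^ δ := by
  -- A prime p ≥ P has p^δ ≥ 2, hence e + 1 ≤ 2^e ≤ p^{eδ} at no cost. Each prime below P costs a
  -- factor `M`, whence the constant `M ^ P`.
  obtain ⟨P, hP⟩ := exists_nat_ge ((2 : ℝ) ^ (1 / δ))
  have hlog : 0 < Real.log 2 := Real.log_pos one_lt_two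
  set M : ℝ := 1 + 1 / (δ * Real.log 2) with hM
  have hM1 : 1 ≤ M := by rw [hM]; have : 0 < 1 / (δ * Real.log 2) := by positivity
                         linarith
  have hfac : ∀ p e : ℕ, p.Prime →
      ((e + 1 : ℕ) : ℝ) ≤ (if p ∈ Finset.range P then M else 1) * ((p : ℝ) ^ e) ^ δ := by
    intro p e hp
    have hp2 : (2 : ℝ) ≤ p := by exact_mod_cast hp.two_le
    split_ifs with h
    · have h1 : ((2 : ℝ) ^ e) ^ δ ≤ ((p : ℝ) ^ e) ^ δ := by gcongr
      have h2 : 1 + e * (δ * Real.log 2) ≤ ((2 : ℝ) ^ e) ^ δ := by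
        rw [Real.rpow_def_of_pos (by positivity), Real.log_pow]
        have := Real.add_one_le_exp (e * Real.log 2 * δ)
        linarith
      have h3 : ((e + 1 : ℕ) : ℝ) ≤ M * (1 + e * (δ * Real.log 2)) := by
        have : M * (1 + e * (δ * Real.log 2)) =
            1 + e + e * (δ * Real.log 2) + 1 / (δ * Real.log 2) := by
          rw [hM]; field_simp; ring
        rw [this]; push_cast
        have : 0 < 1 / (δ * Real.log 2) := by positivity
        have : 0 ≤ e * (δ * Real.log 2) := by positivity
        linarith
      exact h3.trans (by gcongr; linarith)
    · have hpP : (2 : ℝ) ^ (1 / δ) ≤ p := by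
        refine hP.trans ?_
        exact_mod_cast not_lt.mp (fun h' => h (Finset.mem_range.mpr h'))
      have h1 : (2 : ℝ) ≤ (p : ℝ) ^ δ := by
        calc (2 : ℝ) = ((2 : ℝ) ^ (1 / δ)) ^ δ := by
              rw [← Real.rpow_mul (by norm_num), one_div_mul_cancel hδ.ne', Real.rpow_one]
          _ ≤ _ := by gcongr
      have h2 : ((p : ℝ) ^ e) ^ δ = ((p : ℝ) ^ δ) ^ e := by
        rw [← Real.rpow_natCast, ← Real.rpow_natCast, ← Real.rpow_mul (by positivity),
          ← Real.rpow_mul (by positivity), mul_comm]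
      rw [one_mul, h2]
      calc ((e + 1 : ℕ) : ℝ) ≤ (2 : ℝ) ^ e := by exact_mod_cast Nat.lt_two_pow_self
        _ ≤ _ := by gcongr
  refine ⟨M ^ P, one_le_pow₀ hM1, fun k hk => ?_⟩
  have hk' : (k : ℝ) ^ δ = ∏ p ∈ k.primeFactors, ((p : ℝ) ^ k.factorization p) ^ δ := by
    rw [Real.finsetProd_rpow _ _ (fun i _ => by positivity)]
    congr 1
    conv_lhs => rw [← Nat.prod_factorization_pow_eq_self hk]
    rw [Finsupp.prod, Nat.support_factorization]
    push_cast; rfl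
  rw [Nat.card_divisors hk, hk']
  push_cast
  calc ∏ p ∈ k.primeFactors, ((k.factorization p : ℝ) + 1)
      ≤ ∏ p ∈ k.primeFactors, ((if p ∈ Finset.range P then M else 1) *
          ((p : ℝ) ^ k.factorization p) ^ δ) := by
        refine Finset.prod_le_prod (fun i _ => by positivity) fun p hp => ?_
        have := hfac p (k.factorization p) (Nat.prime_of_mem_primeFactors hp)
        push_cast at this
        exact this
    _ ≤ _ := by
        rw [Finset.prod_mul_distrib]
        refine mul_le_mul_of_nonneg_right ?_ (Finset.prod_nonneg fun i _ => by positivity)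
        rw [Finset.prod_ite_mem, Finset.prod_const]
        refine pow_le_pow_right₀ hM1 ?_
        exact (Finset.card_le_card Finset.inter_subset_right).trans_eq (Finset.card_range P)

/-- If `p s < Q` and if `s` is determined by `p s` together with a divisor of a number known from
`p s`, then a divisor of a number known from both, then there are at most `Q * (D * D)` values
of `s`, where `D` bounds the numbers of divisors. -/
theorem card_le_of_divisor_code {α : Type*} [DecidableEq α] (S : Finset α)
    (p w₁ d₁ w₂ d₂ : α → ℕ) (Q D : ℕ) (hp : ∀ s ∈ S, p s < Q)
    (hw₁ : ∀ s ∈ S, ∀ s' ∈ S, p s = p s' → w₁ s = w₁ s')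
    (hd₁ : ∀ s ∈ S, d₁ s ∈ (w₁ s).divisors) (hD₁ : ∀ s ∈ S, (w₁ s).divisors.card ≤ D)
    (hw₂ : ∀ s ∈ S, ∀ s' ∈ S, p s = p s' → d₁ s = d₁ s' → w₂ s = w₂ s')
    (hd₂ : ∀ s ∈ S, d₂ s ∈ (w₂ s).divisors) (hD₂ : ∀ s ∈ S, (w₂ s).divisors.card ≤ D)
    (hinj : ∀ s ∈ S, ∀ s' ∈ S, p s = p s' → d₁ s = d₁ s' → d₂ s = d₂ s' → s = s') :
    S.card ≤ Q * (D * D) := by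
  have h1 : ∀ a ∈ S.image p, (S.filter (p · = a)).card ≤ D * D := by
    intro a _
    have h2 : ∀ b ∈ (S.filter (p · = a)).image d₁,
        ((S.filter (p · = a)).filter (d₁ · = b)).card ≤ D := by
      intro b hb
      obtain ⟨s, hs, rfl⟩ := Finset.mem_image.mp hb
      obtain ⟨hs', rfl⟩ := Finset.mem_filter.mp hs
      refine le_trans ?_ (hD₂ s hs')
      refine Finset.card_le_card_of_injOn d₂ ?_ ?_
      · intro x hx
        simp only [Finset.coe_filter, Finset.mem_filter, Set.mem_ofPred_eq] at hx
        have := hd₂ x hx.1.1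
        rwa [hw₂ x hx.1.1 s hs' hx.1.2 hx.2] at this
      · intro x hx y hy hxy
        simp only [Finset.coe_filter, Finset.mem_filter, Set.mem_ofPred_eq] at hx hy
        exact hinj x hx.1.1 y hy.1.1 (hx.1.2.trans hy.1.2.symm) (hx.2.trans hy.2.symm) hxy
    refine (Finset.card_le_mul_card_image _ _ h2).trans (Nat.mul_le_mul_left _ ?_)
    rcases (S.filter (p · = a)).eq_empty_or_nonempty with h | ⟨s, hs⟩
    · simp [h]
    obtain ⟨hs', rfl⟩ := Finset.mem_filter.mp hs
    refine (Finset.card_le_card ?_).trans (hD₁ s hs')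
    intro b hb
    obtain ⟨x, hx, rfl⟩ := Finset.mem_image.mp hb
    obtain ⟨hx, hxs⟩ := Finset.mem_filter.mp hx
    have := hd₁ x hx
    rwa [hw₁ x hx s hs' hxs] at this
  refine (Finset.card_le_mul_card_image _ _ h1).trans ?_
  rw [mul_comm]
  refine Nat.mul_le_mul_right _ ?_
  refine (Finset.card_le_card (t := Finset.range Q) ?_).trans_eq (Finset.card_range Q)
  intro b hb
  obtain ⟨x, hx, rfl⟩ := Finset.mem_image.mp hb
  exact Finset.mem_range.mpr (hp x hx)

/-! ### Parametrized solutions and their sizes. -/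

/-- The parametrization `t₁ = g y₂ y₃`, `t₂ = g y₁ y₃`, `t₃ = g y₁ y₂` of the solutions of
`m = c₁ / t₁ + c₂ / t₂ + c₃ / t₃`. -/
structure TripleParam (m c₁ c₂ c₃ g y₁ y₂ y₃ : ℕ) : Prop where
  m_pos : 0 < m
  c₁_pos : 0 < c₁
  c₂_pos : 0 < c₂
  c₃_pos : 0 < c₃
  g_pos : 0 < g
  y₁_pos : 0 < y₁
  y₂_pos : 0 < y₂
  y₃_pos : 0 < y₃
  eq : m * g * y₁ * y₂ * y₃ = c₁ * y₁ + c₂ * y₂ + c₃ * y₃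
  -- These two inequalities encode a₁ ≤ a₂ ≤ a₃, since aᵢ = n tᵢ / cᵢ. Coprimality holds because y₃
  -- divides t₁ and c₁/t₁ is reduced.
  le₂₁ : c₂ * y₂ ≤ c₁ * y₁
  le₃₂ : c₃ * y₃ ≤ c₂ * y₂
  coprime : Nat.Coprime c₁ y₃

namespace TripleParam

variable {m n c₁ c₂ c₃ g y₁ y₂ y₃ : ℕ}

theorem mul_le (h : TripleParam m c₁ c₂ c₃ g y₁ y₂ y₃) : m * (g * (y₂ * y₃)) ≤ 3 * c₁ := by
  have h1 := h.eq
  have h2 := h.le₂₁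
  have h3 := h.le₃₂
  refine Nat.le_of_mul_le_mul_right ?_ h.y₁_pos
  calc m * (g * (y₂ * y₃)) * y₁ = m * g * y₁ * y₂ * y₃ := by ring
    _ ≤ 3 * c₁ * y₁ := by rw [h1]; linarith

theorem g_mul_le (h : TripleParam m c₁ c₂ c₃ g y₁ y₂ y₃) (hc : c₁ ≤ n) :
    g * (y₂ * y₃) ≤ 3 * n :=
  (Nat.le_mul_of_pos_left _ h.m_pos).trans (h.mul_le.trans (by omega))

theorem y₂_mul_y₃_le (h : TripleParam m c₁ c₂ c₃ g y₁ y₂ y₃) (hc : c₁ ≤ n) :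
    y₂ * y₃ ≤ 3 * n :=
  (Nat.le_mul_of_pos_left _ h.g_pos).trans (h.g_mul_le hc)

theorem y₃_le (h : TripleParam m c₁ c₂ c₃ g y₁ y₂ y₃) (hc : c₁ ≤ n) : y₃ ≤ 3 * n :=
  (Nat.le_mul_of_pos_left _ h.y₂_pos).trans (h.y₂_mul_y₃_le hc)

theorem y₂_le (h : TripleParam m c₁ c₂ c₃ g y₁ y₂ y₃) (hc : c₁ ≤ n) : y₂ ≤ 3 * n :=
  (Nat.le_mul_of_pos_right _ h.y₃_pos).trans (h.y₂_mul_y₃_le hc)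

theorem m_mul_g_mul_y₃_le (h : TripleParam m c₁ c₂ c₃ g y₁ y₂ y₃) (hc : c₁ ≤ n) :
    m * g * y₃ ≤ 3 * n := by
  have h1 : m * g * y₃ ≤ m * (g * (y₂ * y₃)) := by
    calc m * g * y₃ ≤ m * g * y₃ * y₂ := Nat.le_mul_of_pos_right _ h.y₂_pos
      _ = _ := by ring
  exact h1.trans (h.mul_le.trans (by omega))

theorem g_mul_y₃_le (h : TripleParam m c₁ c₂ c₃ g y₁ y₂ y₃) (hc : c₁ ≤ n) : g * y₃ ≤ 3 * n := by
  refine le_trans ?_ (h.m_mul_g_mul_y₃_le hc)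
  rw [mul_assoc]
  exact Nat.le_mul_of_pos_left _ h.m_pos

theorem g_mul_y₂_le (h : TripleParam m c₁ c₂ c₃ g y₁ y₂ y₃) (hc : c₁ ≤ n) : g * y₂ ≤ 3 * n := by
  refine le_trans ?_ (h.g_mul_le hc)
  rw [← mul_assoc]
  exact Nat.le_mul_of_pos_right _ h.y₃_pos

theorem y₁_dvd (h : TripleParam m c₁ c₂ c₃ g y₁ y₂ y₃) : y₁ ∣ c₂ * y₂ + c₃ * y₃ := by
  have : y₁ ∣ c₁ * y₁ + (c₂ * y₂ + c₃ * y₃) := by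
    rw [← add_assoc, ← h.eq]; exact ⟨m * g * y₂ * y₃, by ring⟩
  exact (Nat.dvd_add_right (Dvd.intro_left _ rfl)).mp this

theorem add_pos (h : TripleParam m c₁ c₂ c₃ g y₁ y₂ y₃) : 0 < c₂ * y₂ + c₃ * y₃ :=
  Nat.add_pos_left (Nat.mul_pos h.c₂_pos h.y₂_pos) _

theorem add_le (h : TripleParam m c₁ c₂ c₃ g y₁ y₂ y₃) (hc : c₁ ≤ n) (hc₂ : c₂ ≤ n)
    (hc₃ : c₃ ≤ n) : c₂ * y₂ + c₃ * y₃ ≤ 6 * n ^ 2 := by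
  have h1 := Nat.mul_le_mul hc₂ (h.y₂_le hc)
  have h2 := Nat.mul_le_mul hc₃ (h.y₃_le hc)
  nlinarith

/-- Size enters through y₁ ∣ c₂ y₂ + c₃ y₃. This is the largest of the bounds on numbers whose
divisors get counted, and it sets the threshold 18 n³ used throughout. -/
theorem g_mul_y₁_mul_y₂_le (h : TripleParam m c₁ c₂ c₃ g y₁ y₂ y₃) (hc : c₁ ≤ n) (hc₂ : c₂ ≤ n)
    (hc₃ : c₃ ≤ n) : g * (y₁ * y₂) ≤ 18 * n ^ 3 := by
  have h1 := (Nat.le_of_dvd h.add_pos h.y₁_dvd).trans (h.add_le hc hc₂ hc₃)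
  have h2 := Nat.mul_le_mul h1 (h.g_mul_y₂_le hc)
  calc g * (y₁ * y₂) = y₁ * (g * y₂) := by ring
    _ ≤ _ := h2
    _ = _ := by ring

theorem one_le_n (h : TripleParam m c₁ c₂ c₃ g y₁ y₂ y₃) (hc : c₁ ≤ n) : 1 ≤ n :=
  h.c₁_pos.trans_le hc

theorem linear_le (h : TripleParam m c₁ c₂ c₃ g y₁ y₂ y₃) (hc : c₁ ≤ n) {k : ℕ}
    (hk : k ≤ 3 * n) : k ≤ 18 * n ^ 3 := by
  have h1 := h.one_le_n hc
  have : n ≤ n ^ 3 := Nat.le_self_pow (by norm_num) n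
  omega

theorem quadratic_le (h : TripleParam m c₁ c₂ c₃ g y₁ y₂ y₃) (hc : c₁ ≤ n) {k : ℕ}
    (hk : k ≤ 6 * n ^ 2) : k ≤ 18 * n ^ 3 := by
  have h1 := h.one_le_n hc
  have : n ^ 2 ≤ n ^ 3 := Nat.pow_le_pow_right h1 (by norm_num)
  omega

end TripleParam

/-! ### Solutions with c₁, c₂, c₃ fixed: four ways to count them. -/

section Count

variable {m n c₁ c₂ c₃ D Q : ℕ} (S : Finset (ℕ × ℕ × ℕ × ℕ))

/-- The solutions are determined, up to divisors, by `y₂ y₃`. -/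
theorem card_le_of_y₂_mul_y₃_lt
    (hS : ∀ s ∈ S, TripleParam m c₁ c₂ c₃ s.1 s.2.1 s.2.2.1 s.2.2.2)
    (hc₁ : c₁ ≤ n) (hc₂ : c₂ ≤ n) (hc₃ : c₃ ≤ n)
    (hD : ∀ k, k ≤ 18 * n ^ 3 → k.divisors.card ≤ D)
    (hQ : ∀ s ∈ S, s.2.2.1 * s.2.2.2 < Q) : S.card ≤ Q * (D * D) := by
  -- The product y₂ y₃ splits in few ways; then y₁ divides the known number c₂ y₂ + c₃ y₃, and the
  -- equation gives g.
  refine card_le_of_divisor_code S (fun s => s.2.2.1 * s.2.2.2) (fun s => s.2.2.1 * s.2.2.2)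
    (fun s => s.2.2.1) (fun s => c₂ * s.2.2.1 + c₃ * s.2.2.2) (fun s => s.2.1) Q D hQ
    (fun _ _ _ _ h => h) (fun s hs => ?_) (fun s hs => ?_) ?_ (fun s hs => ?_) (fun s hs => ?_) ?_
  · have h := hS s hs
    exact Nat.mem_divisors.mpr ⟨Dvd.intro _ rfl, (Nat.mul_pos h.y₂_pos h.y₃_pos).ne'⟩
  · have h := hS s hs
    exact hD _ (h.linear_le hc₁ (h.y₂_mul_y₃_le hc₁))
  · rintro ⟨g, y₁, y₂, y₃⟩ hs ⟨g', y₁', y₂', y₃'⟩ hs' hp hd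
    have h := hS _ hs
    dsimp only at *
    subst hd
    rw [Nat.eq_of_mul_eq_mul_left h.y₂_pos hp]
  · have h := hS s hs
    exact Nat.mem_divisors.mpr ⟨h.y₁_dvd, h.add_pos.ne'⟩
  · have h := hS s hs
    exact hD _ (h.quadratic_le hc₁ (h.add_le hc₁ hc₂ hc₃))
  · rintro ⟨g, y₁, y₂, y₃⟩ hs ⟨g', y₁', y₂', y₃'⟩ hs' hp hd hd'
    have h := hS _ hs
    have h' := hS _ hs'
    dsimp only at *
    subst hd hd'
    obtain rfl := Nat.eq_of_mul_eq_mul_left h.y₂_pos hp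
    have h1 : (m * y₁ * y₂ * y₃) * g = (m * y₁ * y₂ * y₃) * g' := by
      have e := h.eq
      have e' := h'.eq
      calc _ = m * g * y₁ * y₂ * y₃ := by ring
        _ = m * g' * y₁ * y₂ * y₃ := by rw [e, e']
        _ = _ := by ring
    have hpos : 0 < m * y₁ * y₂ * y₃ :=
      Nat.mul_pos (Nat.mul_pos (Nat.mul_pos h.m_pos h.y₁_pos) h.y₂_pos) h.y₃_pos
    rw [Nat.eq_of_mul_eq_mul_left hpos h1]

/-- The solutions are determined, up to divisors, by `g y₃`. -/
theorem card_le_of_g_mul_y₃_lt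
    (hS : ∀ s ∈ S, TripleParam m c₁ c₂ c₃ s.1 s.2.1 s.2.2.1 s.2.2.2)
    (hc₁ : c₁ ≤ n) (hc₂ : c₂ ≤ n) (hc₃ : c₃ ≤ n)
    (hD : ∀ k, k ≤ 18 * n ^ 3 → k.divisors.card ≤ D)
    (hQ : ∀ s ∈ S, s.1 * s.2.2.2 < Q) : S.card ≤ Q * (D * D) := by
  have hlt : ∀ s ∈ S, c₂ < m * s.1 * s.2.2.2 * s.2.1 := by
    intro s hs
    have h := hS s hs
    have e := h.eq
    refine lt_of_mul_lt_mul_right (a := s.2.2.1) ?_ (Nat.zero_le _)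
    have h1 := Nat.mul_pos h.c₁_pos h.y₁_pos
    calc c₂ * s.2.2.1 < m * s.1 * s.2.1 * s.2.2.1 * s.2.2.2 := by rw [e]; omega
      _ = _ := by ring
  -- With k = m g y₃ the equation factors as (k y₁ - c₂)(k y₂ - c₁) = k c₃ y₃ + c₁ c₂, whose right
  -- side is known once g and y₃ are.
  refine card_le_of_divisor_code S (fun s => s.1 * s.2.2.2) (fun s => s.1 * s.2.2.2)
    (fun s => s.2.2.2) (fun s => m * s.1 * s.2.2.2 * (c₃ * s.2.2.2) + c₁ * c₂)
    (fun s => m * s.1 * s.2.2.2 * s.2.1 - c₂) Q D hQ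
    (fun _ _ _ _ h => h) (fun s hs => ?_) (fun s hs => ?_) ?_ (fun s hs => ?_) (fun s hs => ?_) ?_
  · have h := hS s hs
    exact Nat.mem_divisors.mpr ⟨Dvd.intro_left _ rfl, (Nat.mul_pos h.g_pos h.y₃_pos).ne'⟩
  · have h := hS s hs
    exact hD _ (h.linear_le hc₁ (h.g_mul_y₃_le hc₁))
  · rintro ⟨g, y₁, y₂, y₃⟩ hs ⟨g', y₁', y₂', y₃'⟩ hs' hp hd
    have h := hS _ hs
    dsimp only at *
    subst hd
    rw [Nat.eq_of_mul_eq_mul_right h.y₃_pos hp]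
  · have h := hS s hs
    have e := h.eq
    obtain ⟨u, hu⟩ := Nat.exists_eq_add_of_lt (hlt s hs)
    refine Nat.mem_divisors.mpr ⟨?_, (Nat.add_pos_right _ (Nat.mul_pos h.c₁_pos h.c₂_pos)).ne'⟩
    have hsub : m * s.1 * s.2.2.2 * s.2.1 - c₂ = u + 1 := by omega
    rw [hsub]
    obtain ⟨g, y₁, y₂, y₃⟩ := s
    dsimp only at *
    have h1 : (u + 1) * y₂ = c₁ * y₁ + c₃ * y₃ := by
      have : (m * g * y₃ * y₁) * y₂ = c₁ * y₁ + c₂ * y₂ + c₃ * y₃ := by rw [← e]; ring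
      rw [hu] at this
      linarith
    have hZ : ((u + 1 : ℕ) : ℤ) ∣ ((m * g * y₃ * (c₃ * y₃) + c₁ * c₂ : ℕ) : ℤ) := by
      refine ⟨(m * g * y₃ * y₂ : ℤ) - c₁, ?_⟩
      have hu' : (m * g * y₃ * y₁ : ℤ) = c₂ + u + 1 := by exact_mod_cast hu
      have h1' : ((u : ℤ) + 1) * y₂ = c₁ * y₁ + c₃ * y₃ := by exact_mod_cast h1
      push_cast
      linear_combination (m * g * y₃ : ℤ) * (-h1') - (c₁ : ℤ) * hu'
    exact_mod_cast hZ
  · have h := hS s hs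
    refine hD _ ?_
    have h1 := h.one_le_n hc₁
    have h2 : m * s.1 * s.2.2.2 * (c₃ * s.2.2.2) ≤ 3 * n * (n * (3 * n)) :=
      Nat.mul_le_mul (h.m_mul_g_mul_y₃_le hc₁) (Nat.mul_le_mul hc₃ (h.y₃_le hc₁))
    have h3 : c₁ * c₂ ≤ n * n := Nat.mul_le_mul hc₁ hc₂
    have h4 : n * n ≤ n * n * n := Nat.le_mul_of_pos_right _ h1
    calc _ ≤ 3 * n * (n * (3 * n)) + n * n * n := by omega
      _ = 10 * n ^ 3 := by ring
      _ ≤ _ := Nat.mul_le_mul_right _ (by norm_num)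
  · rintro ⟨g, y₁, y₂, y₃⟩ hs ⟨g', y₁', y₂', y₃'⟩ hs' hp hd hd'
    have h := hS _ hs
    have h' := hS _ hs'
    have l := hlt _ hs
    have l' := hlt _ hs'
    dsimp only at *
    subst hd
    obtain rfl := Nat.eq_of_mul_eq_mul_right h.y₃_pos hp
    have h0 : m * g * y₃ * y₁ = m * g * y₃ * y₁' := by omega
    have hpos : 0 < m * g * y₃ := Nat.mul_pos (Nat.mul_pos h.m_pos h.g_pos) h.y₃_pos
    obtain rfl := Nat.eq_of_mul_eq_mul_left hpos h0
    obtain ⟨u, hu⟩ := Nat.exists_eq_add_of_lt l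
    have key : ∀ z, m * g * y₁ * z * y₃ = c₁ * y₁ + c₂ * z + c₃ * y₃ →
        (u + 1) * z = c₁ * y₁ + c₃ * y₃ := by
      intro z hz
      have : (m * g * y₃ * y₁) * z = c₁ * y₁ + c₂ * z + c₃ * y₃ := by rw [← hz]; ring
      rw [hu] at this
      linarith
    rw [Nat.eq_of_mul_eq_mul_left (Nat.succ_pos u) ((key _ h.eq).trans (key _ h'.eq).symm)]

/-- The solutions are determined, up to divisors, by the quotient by `m` of `m g y₂ y₃ - c₁`. -/
theorem card_le_of_g_mul_y₂_mul_y₃_sub_lt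
    (hS : ∀ s ∈ S, TripleParam m c₁ c₂ c₃ s.1 s.2.1 s.2.2.1 s.2.2.2)
    (hc₁ : c₁ ≤ n) (hD : ∀ k, k ≤ 18 * n ^ 3 → k.divisors.card ≤ D)
    (hQ : ∀ s ∈ S, s.1 * (s.2.2.1 * s.2.2.2) - c₁ / m - 1 < Q) : S.card ≤ Q * (D * D) := by
  have hlt : ∀ s ∈ S, c₁ < m * (s.1 * (s.2.2.1 * s.2.2.2)) := by
    intro s hs
    have h := hS s hs
    have e := h.eq
    refine lt_of_mul_lt_mul_right (a := s.2.1) ?_ (Nat.zero_le _)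
    have h1 := h.add_pos
    calc c₁ * s.2.1 < m * s.1 * s.2.1 * s.2.2.1 * s.2.2.2 := by rw [e]; omega
      _ = _ := by ring
  -- Hence the truncated subtraction of `c₁ / m + 1` is exact and loses no information.
  have hlt' : ∀ s ∈ S, c₁ / m < s.1 * (s.2.2.1 * s.2.2.2) := by
    intro s hs
    rw [Nat.div_lt_iff_lt_mul (hS s hs).m_pos, mul_comm]
    exact hlt s hs
  have hw : ∀ s ∈ S, ∀ s' ∈ S, s.1 * (s.2.2.1 * s.2.2.2) - c₁ / m - 1 =
      s'.1 * (s'.2.2.1 * s'.2.2.2) - c₁ / m - 1 →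
      s.1 * (s.2.2.1 * s.2.2.2) = s'.1 * (s'.2.2.1 * s'.2.2.2) := by
    intro s hs s' hs' h
    have h1 := hlt' s hs
    have h2 := hlt' s' hs'
    omega
  refine card_le_of_divisor_code S (fun s => s.1 * (s.2.2.1 * s.2.2.2) - c₁ / m - 1)
    (fun s => s.1 * (s.2.2.1 * s.2.2.2))
    (fun s => s.1) (fun s => s.1 * (s.2.2.1 * s.2.2.2)) (fun s => s.2.2.1) Q D hQ
    hw (fun s hs => ?_) (fun s hs => ?_) (fun s hs s' hs' h _ => hw s hs s' hs' h)
    (fun s hs => ?_) (fun s hs => ?_) ?_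
  · have h := hS s hs
    exact Nat.mem_divisors.mpr ⟨Dvd.intro _ rfl,
      (Nat.mul_pos h.g_pos (Nat.mul_pos h.y₂_pos h.y₃_pos)).ne'⟩
  · have h := hS s hs
    exact hD _ (h.linear_le hc₁ (h.g_mul_le hc₁))
  · have h := hS s hs
    exact Nat.mem_divisors.mpr ⟨⟨s.1 * s.2.2.2, by ring⟩,
      (Nat.mul_pos h.g_pos (Nat.mul_pos h.y₂_pos h.y₃_pos)).ne'⟩
  · have h := hS s hs
    exact hD _ (h.linear_le hc₁ (h.g_mul_le hc₁))
  · intro s hs s' hs' hp hd hd'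
    have hw' := hw s hs s' hs' hp
    have l := hlt _ hs
    have h := hS s hs
    have h' := hS s' hs'
    obtain ⟨g, y₁, y₂, y₃⟩ := s
    obtain ⟨g', y₁', y₂', y₃'⟩ := s'
    dsimp only at *
    subst hd hd'
    obtain rfl := Nat.eq_of_mul_eq_mul_left h.y₂_pos (Nat.eq_of_mul_eq_mul_left h.g_pos hw')
    obtain ⟨u, hu⟩ := Nat.exists_eq_add_of_lt l
    have key : ∀ z, m * g * z * y₂ * y₃ = c₁ * z + c₂ * y₂ + c₃ * y₃ →
        (u + 1) * z = c₂ * y₂ + c₃ * y₃ := by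
      intro z hz
      have : (m * (g * (y₂ * y₃))) * z = c₁ * z + c₂ * y₂ + c₃ * y₃ := by rw [← hz]; ring
      rw [hu] at this
      linarith
    rw [Nat.eq_of_mul_eq_mul_left (Nat.succ_pos u) ((key _ h.eq).trans (key _ h'.eq).symm)]

/-- The equation reads (m g y₁ y₂ - c₃) y₃ = c₁ y₁ + c₂ y₂. The gcd of c₁ and c₂ divides the right
side and is prime to y₃, so it divides the first factor. Dividing it out later replaces c₁ c₂ by an
lcm, which is at most n. -/
theorem TripleParam.exists_mul_eq {g y₁ y₂ y₃ : ℕ}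
    (h : TripleParam m c₁ c₂ c₃ g y₁ y₂ y₃) :
    ∃ f, m * (g * (y₁ * y₂)) = c₃ + Nat.gcd c₁ c₂ * f ∧
      Nat.gcd c₁ c₂ * f * y₃ = c₁ * y₁ + c₂ * y₂ := by
  have e := h.eq
  have l : c₃ < m * (g * (y₁ * y₂)) := by
    refine lt_of_mul_lt_mul_right (a := y₃) ?_ (Nat.zero_le _)
    have h1 := Nat.mul_pos h.c₁_pos h.y₁_pos
    calc c₃ * y₃ < m * g * y₁ * y₂ * y₃ := by rw [e]; omega
      _ = _ := by ring
  obtain ⟨u, hu⟩ := Nat.exists_eq_add_of_lt l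
  have key : (u + 1) * y₃ = c₁ * y₁ + c₂ * y₂ := by
    have : (m * (g * (y₁ * y₂))) * y₃ = c₁ * y₁ + c₂ * y₂ + c₃ * y₃ := by rw [← e]; ring
    rw [hu] at this
    linarith
  have hd : Nat.gcd c₁ c₂ ∣ (u + 1) * y₃ := by
    rw [key]
    exact dvd_add ((Nat.gcd_dvd_left _ _).mul_right _) ((Nat.gcd_dvd_right _ _).mul_right _)
  obtain ⟨f, hf⟩ := (Nat.Coprime.coprime_dvd_left (Nat.gcd_dvd_left c₁ c₂)
    h.coprime).dvd_of_dvd_mul_right hd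
  exact ⟨f, by omega, by rw [← hf, key]⟩

/-- The solutions are determined, up to divisors, by the quotient by `m` of
`(m g y₁ y₂ - c₃) / gcd (c₁, c₂)`. -/
theorem card_le_of_div_gcd_lt
    (hS : ∀ s ∈ S, TripleParam m c₁ c₂ c₃ s.1 s.2.1 s.2.2.1 s.2.2.2)
    (hc₁ : c₁ ≤ n) (hc₂ : c₂ ≤ n) (hc₃ : c₃ ≤ n) (hcop : Nat.Coprime c₁ m)
    (hD : ∀ k, k ≤ 18 * n ^ 3 → k.divisors.card ≤ D)
    (hQ : ∀ s ∈ S, (m * (s.1 * (s.2.1 * s.2.2.1)) - c₃) / Nat.gcd c₁ c₂ / m < Q) :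
    S.card ≤ Q * (D * D) := by
  have hdiv : ∀ s ∈ S, ∃ f, m * (s.1 * (s.2.1 * s.2.2.1)) = c₃ + Nat.gcd c₁ c₂ * f ∧
      (m * (s.1 * (s.2.1 * s.2.2.1)) - c₃) / Nat.gcd c₁ c₂ = f := by
    intro s hs
    obtain ⟨f, hf, -⟩ := (hS s hs).exists_mul_eq
    refine ⟨f, hf, ?_⟩
    rw [hf, Nat.add_sub_cancel_left, Nat.mul_div_cancel_left]
    exact Nat.gcd_pos_of_pos_left _ (hS s hs).c₁_pos
  have hw : ∀ s ∈ S, ∀ s' ∈ S, (m * (s.1 * (s.2.1 * s.2.2.1)) - c₃) / Nat.gcd c₁ c₂ / m =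
      (m * (s'.1 * (s'.2.1 * s'.2.2.1)) - c₃) / Nat.gcd c₁ c₂ / m →
      s.1 * (s.2.1 * s.2.2.1) = s'.1 * (s'.2.1 * s'.2.2.1) := by
    intro s hs s' hs' h
    obtain ⟨f, hf, hf'⟩ := hdiv s hs
    obtain ⟨k, hk, hk'⟩ := hdiv s' hs'
    rw [hf', hk'] at h
    -- Modulo m, gcd(c₁, c₂) f ≡ -c₃ and the gcd is invertible, so the residue of `f` is fixed and
    -- the quotient by m suffices.
    have hmod : f ≡ k [MOD m] := by
      refine Nat.ModEq.cancel_left_of_coprime (c := Nat.gcd c₁ c₂) ?_ ?_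
      · exact (Nat.Coprime.coprime_dvd_left (Nat.gcd_dvd_left c₁ c₂) hcop).symm
      · refine Nat.ModEq.add_left_cancel' c₃ ?_
        rw [← hf, ← hk]
        exact (Nat.modEq_zero_iff_dvd.mpr (Dvd.intro _ rfl)).trans
          (Nat.modEq_zero_iff_dvd.mpr (Dvd.intro _ rfl)).symm
    have hfk : f = k := by
      rw [← Nat.div_add_mod f m, ← Nat.div_add_mod k m, h, hmod]
    rw [hfk, ← hk] at hf
    exact Nat.eq_of_mul_eq_mul_left (hS s hs).m_pos hf
  refine card_le_of_divisor_code S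
    (fun s => (m * (s.1 * (s.2.1 * s.2.2.1)) - c₃) / Nat.gcd c₁ c₂ / m)
    (fun s => s.1 * (s.2.1 * s.2.2.1))
    (fun s => s.1) (fun s => s.1 * (s.2.1 * s.2.2.1)) (fun s => s.2.1) Q D hQ
    hw (fun s hs => ?_) (fun s hs => ?_) (fun s hs s' hs' h _ => hw s hs s' hs' h)
    (fun s hs => ?_) (fun s hs => ?_) ?_
  · have h := hS s hs
    exact Nat.mem_divisors.mpr ⟨Dvd.intro _ rfl,
      (Nat.mul_pos h.g_pos (Nat.mul_pos h.y₁_pos h.y₂_pos)).ne'⟩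
  · have h := hS s hs
    exact hD _ (h.g_mul_y₁_mul_y₂_le hc₁ hc₂ hc₃)
  · have h := hS s hs
    exact Nat.mem_divisors.mpr ⟨⟨s.1 * s.2.2.1, by ring⟩,
      (Nat.mul_pos h.g_pos (Nat.mul_pos h.y₁_pos h.y₂_pos)).ne'⟩
  · have h := hS s hs
    exact hD _ (h.g_mul_y₁_mul_y₂_le hc₁ hc₂ hc₃)
  · intro s hs s' hs' hp hd hd'
    have hw' := hw s hs s' hs' hp
    have h := hS s hs
    have h' := hS s' hs'
    obtain ⟨g, y₁, y₂, y₃⟩ := s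
    obtain ⟨g', y₁', y₂', y₃'⟩ := s'
    dsimp only at *
    subst hd hd'
    obtain rfl := Nat.eq_of_mul_eq_mul_left h.y₁_pos (Nat.eq_of_mul_eq_mul_left h.g_pos hw')
    obtain ⟨f, hf, hf'⟩ := h.exists_mul_eq
    obtain ⟨k, hk, hk'⟩ := h'.exists_mul_eq
    have hfk : Nat.gcd c₁ c₂ * f = Nat.gcd c₁ c₂ * k := by omega
    rw [← hfk] at hk'
    have hpos : 0 < Nat.gcd c₁ c₂ * f := by
      refine Nat.pos_of_ne_zero fun h0 => ?_
      rw [h0, zero_mul] at hf'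
      have := Nat.mul_pos h.c₁_pos h.y₁_pos
      omega
    rw [Nat.eq_of_mul_eq_mul_left hpos (hf'.trans hk'.symm)]

/-- One of the four integers that determine a solution is small. -/
theorem TripleParam.exists_lt {g y₁ y₂ y₃ : ℕ} (h : TripleParam m c₁ c₂ c₃ g y₁ y₂ y₃)
    (hn : 0 < n) (hc₁ : c₁ ∣ n) (hc₂ : c₂ ∣ n) (hQ : 36 * n ^ 3 < Q ^ 5 * m ^ 4) :
    y₂ * y₃ < Q ∨ g * y₃ < Q ∨ g * (y₂ * y₃) - c₁ / m - 1 < Q ∨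
      (m * (g * (y₁ * y₂)) - c₃) / Nat.gcd c₁ c₂ / m < Q := by
  by_contra! hcon
  obtain ⟨hA, hB, hE, hF⟩ := hcon
  obtain ⟨f, hf, hf'⟩ := h.exists_mul_eq
  have hgpos : 0 < Nat.gcd c₁ c₂ := Nat.gcd_pos_of_pos_left _ h.c₁_pos
  rw [hf, Nat.add_sub_cancel_left, Nat.mul_div_cancel_left _ hgpos] at hF
  -- (m g y₂ y₃ - c₁) y₁ = c₂ y₂ + c₃ y₃ ≤ 2 c₂ y₂, and the first factor is at least Q m.
  have hE' : Q * m * y₁ ≤ 2 * (c₂ * y₂) := by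
    have e := h.eq
    have l := h.le₃₂
    have h1 : c₁ < m * (c₁ / m + 1) := Nat.lt_mul_div_succ c₁ h.m_pos
    -- Positivity of `Q` rules out truncation in `hE`.
    have hQ0 : 0 < Q := by
      refine Nat.pos_of_ne_zero fun h0 => ?_
      rw [h0] at hQ; simp at hQ
    have h2 : Q + (c₁ / m + 1) ≤ g * (y₂ * y₃) := by omega
    have h3 := Nat.mul_le_mul_left (m * y₁) h2
    have h4 : c₁ * y₁ ≤ m * (c₁ / m + 1) * y₁ := Nat.mul_le_mul_right _ h1.le
    have h5 : m * y₁ * (g * (y₂ * y₃)) = c₁ * y₁ + c₂ * y₂ + c₃ * y₃ := by rw [← e]; ring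
    rw [h5] at h3
    linarith
  have hF' : Nat.gcd c₁ c₂ * (Q * m) * y₃ ≤ 2 * (c₁ * y₁) := by
    have l := h.le₂₁
    have h1 : Q * m ≤ f := (Nat.mul_le_mul_right _ hF).trans (Nat.div_mul_le_self f m)
    calc Nat.gcd c₁ c₂ * (Q * m) * y₃ ≤ Nat.gcd c₁ c₂ * f * y₃ := by gcongr
      _ = c₁ * y₁ + c₂ * y₂ := hf'
      _ ≤ _ := by omega
  have hlcm : Nat.lcm c₁ c₂ ≤ n := Nat.le_of_dvd hn (Nat.lcm_dvd hc₁ hc₂)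
  -- Multiplying the two estimates cancels y₁, and c₁ c₂ / gcd(c₁, c₂) is the lcm, a divisor of n.
  have hEF : Q ^ 2 * m ^ 2 * y₃ ≤ 4 * (n * y₂) := by
    refine Nat.le_of_mul_le_mul_left ?_ (Nat.mul_pos hgpos h.y₁_pos)
    calc Nat.gcd c₁ c₂ * y₁ * (Q ^ 2 * m ^ 2 * y₃)
        = (Q * m * y₁) * (Nat.gcd c₁ c₂ * (Q * m) * y₃) := by ring
      _ ≤ 2 * (c₂ * y₂) * (2 * (c₁ * y₁)) := Nat.mul_le_mul hE' hF'
      _ = 4 * ((c₁ * c₂) * (y₁ * y₂)) := by ring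
      _ = 4 * ((Nat.gcd c₁ c₂ * Nat.lcm c₁ c₂) * (y₁ * y₂)) := by rw [Nat.gcd_mul_lcm]
      _ ≤ 4 * ((Nat.gcd c₁ c₂ * n) * (y₁ * y₂)) := by gcongr
      _ = _ := by ring
  have hmul : m * (g * (y₂ * y₃)) ≤ 3 * n :=
    h.mul_le.trans (Nat.mul_le_mul_left _ (Nat.le_of_dvd hn hc₁))
  refine absurd hQ (not_lt.mpr ?_)
  -- Using g y₃ ≥ Q twice makes everything collapse to the square of m g y₂ y₃ ≤ 3n.
  calc Q ^ 5 * m ^ 4 = (Q * (Q * Q)) * (Q ^ 2 * m ^ 2) * m ^ 2 := by ring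
    _ ≤ ((y₂ * y₃) * ((g * y₃) * (g * y₃))) * (Q ^ 2 * m ^ 2) * m ^ 2 := by gcongr
    _ = (Q ^ 2 * m ^ 2 * y₃) * (y₂ * (y₃ * y₃) * g ^ 2 * m ^ 2) := by ring
    _ ≤ (4 * (n * y₂)) * (y₂ * (y₃ * y₃) * g ^ 2 * m ^ 2) := by gcongr
    _ = 4 * n * (m * (g * (y₂ * y₃))) ^ 2 := by ring
    _ ≤ 4 * n * (3 * n) ^ 2 := by gcongr
    _ = 36 * n ^ 3 := by ring

/-- The number of solutions with given `c₁`, `c₂`, `c₃`. -/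
theorem card_tripleParam_le
    (hS : ∀ s ∈ S, TripleParam m c₁ c₂ c₃ s.1 s.2.1 s.2.2.1 s.2.2.2) (hn : 0 < n)
    (hc₁ : c₁ ∣ n) (hc₂ : c₂ ∣ n) (hc₃ : c₃ ∣ n) (hcop : Nat.Coprime n m)
    (hD : ∀ k, k ≤ 18 * n ^ 3 → k.divisors.card ≤ D) (hQ : 36 * n ^ 3 < Q ^ 5 * m ^ 4) :
    S.card ≤ 4 * (Q * (D * D)) := by
  have l₁ := Nat.le_of_dvd hn hc₁
  have l₂ := Nat.le_of_dvd hn hc₂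
  have l₃ := Nat.le_of_dvd hn hc₃
  set SA := S.filter fun s => s.2.2.1 * s.2.2.2 < Q with hSA
  set SB := S.filter fun s => s.1 * s.2.2.2 < Q with hSB
  set SE := S.filter fun s => s.1 * (s.2.2.1 * s.2.2.2) - c₁ / m - 1 < Q with hSE
  set SF := S.filter fun s => (m * (s.1 * (s.2.1 * s.2.2.1)) - c₃) / Nat.gcd c₁ c₂ / m < Q with hSF
  have hsub : S ⊆ (SA ∪ SB) ∪ (SE ∪ SF) := by
    intro s hs
    simp only [hSA, hSB, hSE, hSF, Finset.mem_union, Finset.mem_filter]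
    have := (hS s hs).exists_lt hn hc₁ hc₂ hQ
    tauto
  have hA : SA.card ≤ Q * (D * D) :=
    card_le_of_y₂_mul_y₃_lt SA (fun s hs => hS s (Finset.mem_filter.mp hs).1) l₁ l₂ l₃ hD
      fun s hs => (Finset.mem_filter.mp hs).2
  have hB : SB.card ≤ Q * (D * D) :=
    card_le_of_g_mul_y₃_lt SB (fun s hs => hS s (Finset.mem_filter.mp hs).1) l₁ l₂ l₃ hD
      fun s hs => (Finset.mem_filter.mp hs).2
  have hE : SE.card ≤ Q * (D * D) :=
    card_le_of_g_mul_y₂_mul_y₃_sub_lt SE (fun s hs => hS s (Finset.mem_filter.mp hs).1) l₁ hD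
      fun s hs => (Finset.mem_filter.mp hs).2
  have hF : SF.card ≤ Q * (D * D) :=
    card_le_of_div_gcd_lt SF (fun s hs => hS s (Finset.mem_filter.mp hs).1) l₁ l₂ l₃
      (hcop.coprime_dvd_left hc₁) hD fun s hs => (Finset.mem_filter.mp hs).2
  have h1 := Finset.card_le_card hsub
  have h2 := Finset.card_union_le (SA ∪ SB) (SE ∪ SF)
  have h3 := Finset.card_union_le SA SB
  have h4 := Finset.card_union_le SE SF
  omega

end Count

/-! ### From unit fractions to parameters. -/

/-- If `m = c₁ / t₁ + c₂ / t₂ + c₃ / t₃` with fractions in lowest terms, then the denominators are of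
the form `g y₂ y₃`, `g y₁ y₃`, `g y₁ y₂`. -/
theorem exists_eq_mul_of_unit_equation {m c₁ c₂ c₃ t₁ t₂ t₃ : ℕ} (h₁ : 0 < t₁) (h₂ : 0 < t₂)
    (h₃ : 0 < t₃) (k₁ : Nat.Coprime c₁ t₁) (k₂ : Nat.Coprime c₂ t₂) (k₃ : Nat.Coprime c₃ t₃)
    (h : m * t₁ * t₂ * t₃ = c₁ * (t₂ * t₃) + c₂ * (t₁ * t₃) + c₃ * (t₁ * t₂)) :
    ∃ g y₁ y₂ y₃ : ℕ, t₁ = g * (y₂ * y₃) ∧ t₂ = g * (y₁ * y₃) ∧ t₃ = g * (y₁ * y₂) ∧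
      m * g * y₁ * y₂ * y₃ = c₁ * y₁ + c₂ * y₂ + c₃ * y₃ := by
  set g := Nat.gcd t₁ (Nat.gcd t₂ t₃) with hg
  have hg0 : 0 < g := Nat.gcd_pos_of_pos_left _ h₁
  obtain ⟨s₁, e₁⟩ : g ∣ t₁ := Nat.gcd_dvd_left _ _
  obtain ⟨s₂, e₂⟩ : g ∣ t₂ := (Nat.gcd_dvd_right _ _).trans (Nat.gcd_dvd_left _ _)
  obtain ⟨s₃, e₃⟩ : g ∣ t₃ := (Nat.gcd_dvd_right _ _).trans (Nat.gcd_dvd_right _ _)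
  have hs : Nat.gcd s₁ (Nat.gcd s₂ s₃) = 1 := by
    have : g * Nat.gcd s₁ (Nat.gcd s₂ s₃) = g * 1 := by
      rw [← Nat.gcd_mul_left, ← Nat.gcd_mul_left, ← e₁, ← e₂, ← e₃, mul_one]
    exact Nat.eq_of_mul_eq_mul_left hg0 this
  have p₁ : 0 < s₁ := Nat.pos_of_ne_zero (by rintro rfl; simp at e₁; omega)
  have p₂ : 0 < s₂ := Nat.pos_of_ne_zero (by rintro rfl; simp at e₂; omega)
  have p₃ : 0 < s₃ := Nat.pos_of_ne_zero (by rintro rfl; simp at e₃; omega)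
  have hs' : m * g * s₁ * s₂ * s₃ = c₁ * (s₂ * s₃) + c₂ * (s₁ * s₃) + c₃ * (s₁ * s₂) := by
    rw [e₁, e₂, e₃] at h
    refine Nat.eq_of_mul_eq_mul_left (Nat.mul_pos hg0 hg0) ?_
    linarith
  -- Reduced modulo s₁, the equation leaves only c₁ s₂ s₃, and c₁ is prime to s₁.
  have d₁ : s₁ ∣ s₂ * s₃ := by
    have hc : Nat.Coprime s₁ c₁ := (k₁.coprime_dvd_right (Dvd.intro_left _ e₁.symm)).symm
    refine hc.dvd_of_dvd_mul_left ?_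
    have : s₁ ∣ c₁ * (s₂ * s₃) + s₁ * (c₂ * s₃ + c₃ * s₂) :=
      ⟨m * g * s₂ * s₃, by linarith⟩
    exact (Nat.dvd_add_left (Dvd.intro _ rfl)).mp this
  have d₂ : s₂ ∣ s₁ * s₃ := by
    have hc : Nat.Coprime s₂ c₂ := (k₂.coprime_dvd_right (Dvd.intro_left _ e₂.symm)).symm
    refine hc.dvd_of_dvd_mul_left ?_
    have : s₂ ∣ c₂ * (s₁ * s₃) + s₂ * (c₁ * s₃ + c₃ * s₁) :=
      ⟨m * g * s₁ * s₃, by linarith⟩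
    exact (Nat.dvd_add_left (Dvd.intro _ rfl)).mp this
  have d₃ : s₃ ∣ s₁ * s₂ := by
    have hc : Nat.Coprime s₃ c₃ := (k₃.coprime_dvd_right (Dvd.intro_left _ e₃.symm)).symm
    refine hc.dvd_of_dvd_mul_left ?_
    have : s₃ ∣ c₃ * (s₁ * s₂) + s₃ * (c₁ * s₂ + c₂ * s₁) :=
      ⟨m * g * s₁ * s₂, by linarith⟩
    exact (Nat.dvd_add_left (Dvd.intro _ rfl)).mp this
  -- When no prime divides all three numbers, gcd(a, b) and gcd(a, c) are coprime divisors of a, and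
  -- a ∣ bc forces their product to be a.
  have split : ∀ a b c : ℕ, a ∣ b * c → Nat.gcd a (Nat.gcd b c) = 1 →
      a = Nat.gcd a b * Nat.gcd a c := by
    intro a b c hd hgcd
    refine Nat.dvd_antisymm ?_ ?_
    · exact (Nat.dvd_gcd dvd_rfl hd).trans (Nat.gcd_mul_right_dvd_mul_gcd a b c)
    · refine Nat.Coprime.mul_dvd_of_dvd_of_dvd ?_ (Nat.gcd_dvd_left _ _) (Nat.gcd_dvd_left _ _)
      refine Nat.eq_one_of_dvd_one (hgcd ▸ ?_)
      refine Nat.dvd_gcd ((Nat.gcd_dvd_left _ _).trans (Nat.gcd_dvd_left _ _)) (Nat.dvd_gcd ?_ ?_)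
      · exact (Nat.gcd_dvd_left _ _).trans (Nat.gcd_dvd_right _ _)
      · exact (Nat.gcd_dvd_right _ _).trans (Nat.gcd_dvd_right _ _)
  have f₁ := split s₁ s₂ s₃ d₁ hs
  have f₂ := split s₂ s₁ s₃ d₂ (by rw [← hs, ← Nat.gcd_assoc, Nat.gcd_comm s₂, Nat.gcd_assoc])
  have f₃ := split s₃ s₁ s₂ d₃ (by rw [← hs, Nat.gcd_comm, Nat.gcd_assoc])
  rw [Nat.gcd_comm s₂ s₁] at f₂
  rw [Nat.gcd_comm s₃ s₁, Nat.gcd_comm s₃ s₂] at f₃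
  set y₁ := Nat.gcd s₂ s₃
  set y₂ := Nat.gcd s₁ s₃
  set y₃ := Nat.gcd s₁ s₂
  refine ⟨g, y₁, y₂, y₃, by rw [e₁, f₁, mul_comm y₃], by rw [e₂, f₂, mul_comm y₃],
    by rw [e₃, f₃, mul_comm y₂], ?_⟩
  have q₁ : 0 < y₁ := Nat.gcd_pos_of_pos_left _ p₂
  have q₂ : 0 < y₂ := Nat.gcd_pos_of_pos_left _ p₁
  have q₃ : 0 < y₃ := Nat.gcd_pos_of_pos_left _ p₁
  refine Nat.eq_of_mul_eq_mul_left (Nat.mul_pos (Nat.mul_pos q₁ q₂) q₃) ?_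
  rw [f₁, f₂, f₃] at hs'
  linarith

/-- A representation as a sum of three unit fractions gives parameters. -/
theorem exists_tripleParam {m n a₁ a₂ a₃ : ℕ} (hm : 0 < m) (hn : 0 < n) (h₁ : 0 < a₁)
    (l₁₂ : a₁ ≤ a₂) (l₂₃ : a₂ ≤ a₃)
    (h : m * a₁ * a₂ * a₃ = n * (a₂ * a₃ + a₁ * a₃ + a₁ * a₂)) :
    ∃ g y₁ y₂ y₃ : ℕ,
      TripleParam m (n / Nat.gcd a₁ n) (n / Nat.gcd a₂ n) (n / Nat.gcd a₃ n) g y₁ y₂ y₃ ∧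
      n / Nat.gcd a₁ n * a₁ = n * (g * (y₂ * y₃)) ∧
      n / Nat.gcd a₂ n * a₂ = n * (g * (y₁ * y₃)) ∧
      n / Nat.gcd a₃ n * a₃ = n * (g * (y₁ * y₂)) := by
  have h₂ : 0 < a₂ := h₁.trans_le l₁₂
  have h₃ : 0 < a₃ := h₂.trans_le l₂₃
  have red : ∀ a, 0 < a → ∃ t c, n / Nat.gcd a n = c ∧ c * a = n * t ∧ Nat.Coprime c t ∧
      0 < t ∧ 0 < c := by
    intro a ha
    have hd : 0 < Nat.gcd a n := Nat.gcd_pos_of_pos_left _ ha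
    obtain ⟨t, ht⟩ := Nat.gcd_dvd_left a n
    obtain ⟨c, hc⟩ := Nat.gcd_dvd_right a n
    have ht' : a / Nat.gcd a n = t := Nat.div_eq_of_eq_mul_right hd ht
    have hc' : n / Nat.gcd a n = c := Nat.div_eq_of_eq_mul_right hd hc
    refine ⟨t, c, hc', ?_, ?_, ?_, ?_⟩
    · calc c * a = c * (Nat.gcd a n * t) := by rw [← ht]
        _ = Nat.gcd a n * c * t := by ring
        _ = n * t := by rw [← hc]
    · rw [← ht', ← hc']; exact (Nat.coprime_div_gcd_div_gcd hd).symm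
    · exact ht' ▸ Nat.div_pos (Nat.le_of_dvd ha (Nat.gcd_dvd_left _ _)) hd
    · exact hc' ▸ Nat.div_pos (Nat.le_of_dvd hn (Nat.gcd_dvd_right _ _)) hd
  obtain ⟨t₁, c₁, hc₁, e₁, k₁, p₁, r₁⟩ := red a₁ h₁
  obtain ⟨t₂, c₂, hc₂, e₂, k₂, p₂, r₂⟩ := red a₂ h₂
  obtain ⟨t₃, c₃, hc₃, e₃, k₃, p₃, r₃⟩ := red a₃ h₃
  have ht : m * t₁ * t₂ * t₃ = c₁ * (t₂ * t₃) + c₂ * (t₁ * t₃) + c₃ * (t₁ * t₂) := by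
    refine Nat.eq_of_mul_eq_mul_left (Nat.mul_pos (Nat.mul_pos hn hn) hn) ?_
    calc n * n * n * (m * t₁ * t₂ * t₃) = m * (n * t₁) * (n * t₂) * (n * t₃) := by ring
      _ = c₁ * c₂ * c₃ * (m * a₁ * a₂ * a₃) := by rw [← e₁, ← e₂, ← e₃]; ring
      _ = n * (c₁ * ((c₂ * a₂) * (c₃ * a₃)) + c₂ * ((c₁ * a₁) * (c₃ * a₃)) +
            c₃ * ((c₁ * a₁) * (c₂ * a₂))) := by rw [h]; ring
      _ = _ := by rw [e₁, e₂, e₃]; ring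
  obtain ⟨g, y₁, y₂, y₃, u₁, u₂, u₃, hy⟩ := exists_eq_mul_of_unit_equation p₁ p₂ p₃ k₁ k₂ k₃ ht
  rw [hc₁, hc₂, hc₃]
  have pos₁ := Nat.pos_of_ne_zero fun h0 : g = 0 => by simp [h0] at u₁; omega
  have pos₂ := Nat.pos_of_ne_zero fun h0 : y₁ = 0 => by simp [h0] at u₂; omega
  have pos₃ := Nat.pos_of_ne_zero fun h0 : y₂ = 0 => by simp [h0] at u₁; omega
  have pos₄ := Nat.pos_of_ne_zero fun h0 : y₃ = 0 => by simp [h0] at u₁; omega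
  refine ⟨g, y₁, y₂, y₃, ⟨hm, r₁, r₂, r₃, pos₁, pos₂, pos₃, pos₄, hy, ?_, ?_, ?_⟩,
    by rw [e₁, u₁], by rw [e₂, u₂], by rw [e₃, u₃]⟩
  · refine Nat.le_of_mul_le_mul_left ?_ (Nat.mul_pos (Nat.mul_pos hn pos₁) pos₄)
    calc n * g * y₃ * (c₂ * y₂) = c₂ * (n * t₁) := by rw [u₁]; ring
      _ = c₂ * c₁ * a₁ := by rw [← e₁]; ring
      _ ≤ c₂ * c₁ * a₂ := by gcongr
      _ = c₁ * (n * t₂) := by rw [← e₂]; ring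
      _ = _ := by rw [u₂]; ring
  · refine Nat.le_of_mul_le_mul_left ?_ (Nat.mul_pos (Nat.mul_pos hn pos₁) pos₂)
    calc n * g * y₁ * (c₃ * y₃) = c₃ * (n * t₂) := by rw [u₂]; ring
      _ = c₃ * c₂ * a₂ := by rw [← e₂]; ring
      _ ≤ c₃ * c₂ * a₃ := by gcongr
      _ = c₂ * (n * t₃) := by rw [← e₃]; ring
      _ = _ := by rw [u₃]; ring
  · refine k₁.coprime_dvd_right ⟨g * y₂, by rw [u₁]; ring⟩

/-! ### The bound for three unit fractions. -/

/-- The number of representations as a sum of three unit fractions, in terms of a bound `D` for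
the number of divisors. -/
theorem ncard_unitFractionReps_three_le {q : ℚ} {m D Q : ℕ} (hm : 0 < m) (hq : q.num = m)
    (hD : ∀ k, k ≤ 18 * q.den ^ 3 → k.divisors.card ≤ D)
    (hQ : 36 * q.den ^ 3 < Q ^ 5 * m ^ 4) :
    (unitFractionReps 3 q).ncard ≤ 4 * (Q * D ^ 5) := by
  classical
  set n := q.den with hn
  have hn0 : 0 < n := q.den_pos
  have hcop : Nat.Coprime n m := by
    have := q.reduced
    rw [hq, Int.natAbs_natCast] at this
    exact this.symm
  set R := (unitFractionReps_finite 3 q).toFinset with hR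
  rw [Set.ncard_eq_toFinset_card _ (unitFractionReps_finite 3 q), ← hR]
  have hmem : ∀ a ∈ R, (0 < a 0 ∧ a 0 ≤ a 1 ∧ a 1 ≤ a 2) ∧
      m * a 0 * a 1 * a 2 = n * (a 1 * a 2 + a 0 * a 2 + a 0 * a 1) := by
    intro a ha
    rw [hR, Set.Finite.mem_toFinset] at ha
    obtain ⟨hpos, hmono, hsum⟩ := ha
    refine ⟨⟨hpos 0, hmono (by decide), hmono (by decide)⟩, ?_⟩
    have h0 : (a 0 : ℚ) ≠ 0 := by exact_mod_cast (hpos 0).ne'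
    have h1 : (a 1 : ℚ) ≠ 0 := by exact_mod_cast (hpos 1).ne'
    have h2 : (a 2 : ℚ) ≠ 0 := by exact_mod_cast (hpos 2).ne'
    have hnQ : (n : ℚ) ≠ 0 := by exact_mod_cast hn0.ne'
    have hmn : q * n = m := by
      rw [hn, Rat.mul_den_eq_num, hq]; simp
    rw [Fin.sum_univ_three] at hsum
    have : (m * a 0 * a 1 * a 2 : ℚ) = n * (a 1 * a 2 + a 0 * a 2 + a 0 * a 1) := by
      rw [← hmn, hsum]; field_simp
    exact_mod_cast this
  have hex : ∀ a ∈ R, _ := fun a ha =>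
    exists_tripleParam hm hn0 (hmem a ha).1.1 (hmem a ha).1.2.1 (hmem a ha).1.2.2 (hmem a ha).2
  choose! G Y₁ Y₂ Y₃ hp e₁ e₂ e₃ using hex
  set c : (Fin 3 → ℕ) → ℕ × ℕ × ℕ := fun a =>
    (n / Nat.gcd (a 0) n, n / Nat.gcd (a 1) n, n / Nat.gcd (a 2) n) with hc
  set φ : (Fin 3 → ℕ) → ℕ × ℕ × ℕ × ℕ := fun a => (G a, Y₁ a, Y₂ a, Y₃ a) with hφ
  have hdiv : ∀ x, n / Nat.gcd x n ∣ n := fun x => Nat.div_dvd_of_dvd (Nat.gcd_dvd_right _ _)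
  -- For a fixed triple of cᵢ two divisor choices cost D²; the triples of divisors of n cost a
  -- further D³.
  have hfib : ∀ b ∈ R.image c, (R.filter (c · = b)).card ≤ 4 * (Q * (D * D)) := by
    intro b hb
    obtain ⟨a₀, ha₀, rfl⟩ := Finset.mem_image.mp hb
    have hinj : Set.InjOn φ (R.filter (c · = c a₀)) := by
      intro a ha a' ha' haa
      simp only [Finset.coe_filter, Set.mem_ofPred_eq] at ha ha'
      have hcc : c a = c a' := ha.2.trans ha'.2.symm
      simp only [hc, hφ, Prod.mk.injEq] at hcc haa
      obtain ⟨c1, c2, c3⟩ := hcc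
      obtain ⟨g1, g2, g3, g4⟩ := haa
      have hpa := hp a ha.1
      have s₁ := e₁ a ha.1
      have s₂ := e₂ a ha.1
      have s₃ := e₃ a ha.1
      rw [g1, g3, g4, ← e₁ a' ha'.1, ← c1] at s₁
      rw [g1, g2, g4, ← e₂ a' ha'.1, ← c2] at s₂
      rw [g1, g2, g3, ← e₃ a' ha'.1, ← c3] at s₃
      funext i
      fin_cases i
      · exact Nat.eq_of_mul_eq_mul_left hpa.c₁_pos s₁
      · exact Nat.eq_of_mul_eq_mul_left hpa.c₂_pos s₂
      · exact Nat.eq_of_mul_eq_mul_left hpa.c₃_pos s₃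
    rw [← Finset.card_image_of_injOn hinj]
    refine card_tripleParam_le (m := m) (n := n) (c₁ := (c a₀).1) (c₂ := (c a₀).2.1)
      (c₃ := (c a₀).2.2) _ ?_ hn0 (hdiv _) (hdiv _) (hdiv _) hcop hD hQ
    intro s hs
    obtain ⟨a, ha, rfl⟩ := Finset.mem_image.mp hs
    obtain ⟨ha, hca⟩ := Finset.mem_filter.mp ha
    rw [← hca]
    exact hp a ha
  have hτ : n.divisors.card ≤ D := by
    refine hD n ?_
    have : n ≤ n ^ 3 := Nat.le_self_pow (by norm_num) n
    omega
  have himg : (R.image c).card ≤ D * (D * D) := by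
    calc (R.image c).card ≤ (n.divisors ×ˢ n.divisors ×ˢ n.divisors).card := by
          refine Finset.card_le_card fun b hb => ?_
          obtain ⟨a, -, rfl⟩ := Finset.mem_image.mp hb
          simp only [hc, Finset.mem_product, Nat.mem_divisors]
          exact ⟨⟨hdiv _, hn0.ne'⟩, ⟨hdiv _, hn0.ne'⟩, ⟨hdiv _, hn0.ne'⟩⟩
      _ = n.divisors.card * (n.divisors.card * n.divisors.card) := by
          rw [Finset.card_product, Finset.card_product]
      _ ≤ _ := by gcongr
  calc R.card ≤ 4 * (Q * (D * D)) * (R.image c).card := Finset.card_le_mul_card_image _ _ hfib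
    _ ≤ 4 * (Q * (D * D)) * (D * (D * D)) := by gcongr
    _ = _ := by ring

/-- The number of representations as a sum of three unit fractions. -/
theorem exists_ncard_unitFractionReps_three_le {ε : ℝ} (hε : 0 < ε) :
    ∃ C : ℝ, 1 ≤ C ∧ ∀ q : ℚ, 0 < q → ((unitFractionReps 3 q).ncard : ℝ) ≤
      C * (q.den : ℝ) ^ ε * (1 + (q.den : ℝ) ^ (3 / 5 : ℝ) * (q.num : ℝ) ^ (-(4 / 5) : ℝ)) := by
  -- Divisors of numbers up to 18 n³ are counted, and `D` enters to the fifth power: 15 = 3 · 5.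
  obtain ⟨C₀, hC₀, hdiv⟩ := exists_card_divisors_le_rpow (δ := ε / 15) (by positivity)
  set A : ℝ := C₀ * (18 : ℝ) ^ (ε / 15) with hA
  have hA1 : 1 ≤ A := one_le_mul_of_one_le_of_one_le hC₀
    (Real.one_le_rpow (by norm_num) (by positivity))
  refine ⟨16 * A ^ 5, by have := one_le_pow₀ hA1 (n := 5); linarith, fun q hq => ?_⟩
  obtain ⟨m, hm⟩ := Int.eq_ofNat_of_zero_le (Rat.num_nonneg.mpr hq.le)
  have hm0 : 0 < m := by
    have := Rat.num_pos.mpr hq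
    omega
  set n := q.den with hn
  have hn0 : 0 < n := q.den_pos
  have hnR : (1 : ℝ) ≤ n := by exact_mod_cast hn0
  have hmR : (0 : ℝ) < m := by exact_mod_cast hm0
  set D : ℕ := ⌊A * (n : ℝ) ^ (ε / 5)⌋₊ with hDdef
  have hDle : (D : ℝ) ≤ A * (n : ℝ) ^ (ε / 5) := Nat.floor_le (by positivity)
  have hD : ∀ k, k ≤ 18 * n ^ 3 → k.divisors.card ≤ D := by
    intro k hk
    rcases Nat.eq_zero_or_pos k with rfl | hk0
    · simp
    refine Nat.le_floor ((hdiv k hk0.ne').trans ?_)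
    have h1 : (k : ℝ) ≤ 18 * (n : ℝ) ^ 3 := by exact_mod_cast hk
    calc C₀ * (k : ℝ) ^ (ε / 15) ≤ C₀ * (18 * (n : ℝ) ^ 3) ^ (ε / 15) := by gcongr
      _ = A * (n : ℝ) ^ (ε / 5) := by
        rw [Real.mul_rpow (by norm_num) (by positivity), ← Real.rpow_natCast (n : ℝ) 3,
          ← Real.rpow_mul (by positivity), hA]
        rw [show ((3 : ℕ) : ℝ) * (ε / 15) = ε / 5 by push_cast; ring]
        ring
  -- The factor 3 works because 3⁵ = 243 exceeds 36; `Q` will be `⌊β⌋₊ + 1`.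
  set β : ℝ := 3 * ((n : ℝ) ^ (3 / 5 : ℝ) * (m : ℝ) ^ (-(4 / 5) : ℝ)) with hβ
  have hβ0 : 0 ≤ β := by positivity
  have hβ5 : β ^ 5 * (m : ℝ) ^ 4 = 243 * (n : ℝ) ^ 3 := by
    have h1 : ((n : ℝ) ^ (3 / 5 : ℝ)) ^ 5 = (n : ℝ) ^ 3 := by
      rw [← Real.rpow_natCast, ← Real.rpow_mul (by positivity), ← Real.rpow_natCast]
      norm_num
    have h2 : ((m : ℝ) ^ (-(4 / 5) : ℝ)) ^ 5 * (m : ℝ) ^ 4 = 1 := by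
      rw [← Real.rpow_natCast, ← Real.rpow_mul (by positivity), ← Real.rpow_natCast,
        ← Real.rpow_add hmR]
      norm_num
    calc β ^ 5 * (m : ℝ) ^ 4 = 243 * ((n : ℝ) ^ (3 / 5 : ℝ)) ^ 5 *
          (((m : ℝ) ^ (-(4 / 5) : ℝ)) ^ 5 * (m : ℝ) ^ 4) := by rw [hβ]; ring
      _ = _ := by rw [h1, h2, mul_one]
  have hQ : 36 * n ^ 3 < (⌊β⌋₊ + 1) ^ 5 * m ^ 4 := by
    have h1 : β < (⌊β⌋₊ + 1 : ℕ) := by push_cast; exact Nat.lt_floor_add_one β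
    have h2 : β ^ 5 * (m : ℝ) ^ 4 < ((⌊β⌋₊ + 1 : ℕ) : ℝ) ^ 5 * (m : ℝ) ^ 4 := by gcongr
    rw [hβ5] at h2
    have h3 : (36 * (n : ℝ) ^ 3) < ((⌊β⌋₊ + 1 : ℕ) : ℝ) ^ 5 * (m : ℝ) ^ 4 := by
      have : 0 ≤ (n : ℝ) ^ 3 := by positivity
      linarith
    exact_mod_cast h3
  have hmain := ncard_unitFractionReps_three_le hm0 hm hD hQ
  have hmain' : ((unitFractionReps 3 q).ncard : ℝ) ≤ 4 * (((⌊β⌋₊ : ℝ) + 1) * (D : ℝ) ^ 5) := by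
    exact_mod_cast hmain
  have hfl : (⌊β⌋₊ : ℝ) ≤ β := Nat.floor_le hβ0
  have hD5 : (D : ℝ) ^ 5 ≤ A ^ 5 * (n : ℝ) ^ ε := by
    calc (D : ℝ) ^ 5 ≤ (A * (n : ℝ) ^ (ε / 5)) ^ 5 := by gcongr
      _ = A ^ 5 * (n : ℝ) ^ ε := by
        rw [mul_pow, ← Real.rpow_natCast ((n : ℝ) ^ (ε / 5)), ← Real.rpow_mul (by positivity)]
        norm_num
  have hcast : (q.num : ℝ) = m := by rw [hm]; simp
  rw [hcast]
  refine hmain'.trans ?_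
  set x := (n : ℝ) ^ (3 / 5 : ℝ) * (m : ℝ) ^ (-(4 / 5) : ℝ) with hx
  have hx0 : 0 ≤ x := by positivity
  calc 4 * (((⌊β⌋₊ : ℝ) + 1) * (D : ℝ) ^ 5) ≤ 4 * ((3 * x + 1) * (A ^ 5 * (n : ℝ) ^ ε)) := by
        gcongr
    _ ≤ 4 * ((4 * (1 + x)) * (A ^ 5 * (n : ℝ) ^ ε)) := by gcongr; linarith
    _ = _ := by ring

/-! ### From three to four unit fractions. -/

/-- Telescoping: by Bernoulli's inequality for the concave power 1/5, each term is at most 5 times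
the increment of x ↦ x^{1/5}. -/
theorem sum_range_rpow_neg_le (J : ℕ) :
    ∑ j ∈ Finset.range J, ((j : ℝ) + 1) ^ (-(4 / 5) : ℝ) ≤ 5 * (J : ℝ) ^ (1 / 5 : ℝ) := by
  induction J with
  | zero => simp
  | succ J ih =>
    rw [Finset.sum_range_succ]
    have hJ : (0 : ℝ) < (J : ℝ) + 1 := by positivity
    have h1 : ((J : ℝ) / (J + 1)) ^ (1 / 5 : ℝ) ≤ 1 - 1 / 5 * (1 / (J + 1)) := by
      have := rpow_one_add_le_one_add_mul_self (s := -(1 / ((J : ℝ) + 1))) (p := 1 / 5)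
        (by rw [neg_le_neg_iff, div_le_one hJ]; linarith [Nat.cast_nonneg (α := ℝ) J])
        (by norm_num) (by norm_num)
      rw [show 1 + -(1 / ((J : ℝ) + 1)) = J / (J + 1) by field_simp; ring] at this
      linarith
    have h2 : (J : ℝ) ^ (1 / 5 : ℝ) ≤
        ((J : ℝ) + 1) ^ (1 / 5 : ℝ) - 1 / 5 * ((J : ℝ) + 1) ^ (-(4 / 5) : ℝ) := by
      calc (J : ℝ) ^ (1 / 5 : ℝ) = ((J : ℝ) + 1) ^ (1 / 5 : ℝ) * (J / (J + 1)) ^ (1 / 5 : ℝ) := by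
            rw [← Real.mul_rpow hJ.le (by positivity), mul_div_cancel₀ _ hJ.ne']
        _ ≤ ((J : ℝ) + 1) ^ (1 / 5 : ℝ) * (1 - 1 / 5 * (1 / (J + 1))) := by gcongr
        _ = ((J : ℝ) + 1) ^ (1 / 5 : ℝ) -
            1 / 5 * (((J : ℝ) + 1) ^ (1 / 5 : ℝ) / (J + 1)) := by ring
        _ = _ := by
            rw [← Real.rpow_sub_one hJ.ne']; norm_num
    push_cast
    linarith

/-- Splitting off the smallest denominator. -/
theorem ncard_unitFractionReps_four_le {q : ℚ} {m : ℕ} (hq : q.num = m) :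
    (unitFractionReps 4 q).ncard ≤
      ∑ a ∈ (Finset.range (4 * q.den + 1)).filter (fun a => q.den < m * a ∧ m * a ≤ 4 * q.den),
        (unitFractionReps 3 (q - 1 / (a : ℚ))).ncard := by
  classical
  set n := q.den with hn
  have hn0 : 0 < n := q.den_pos
  have hmn : q * n = m := by
    rw [hn, Rat.mul_den_eq_num, hq, Int.cast_natCast]
  have hnQ : (0 : ℚ) < n := by exact_mod_cast hn0
  set A := (Finset.range (4 * n + 1)).filter (fun a => n < m * a ∧ m * a ≤ 4 * n) with hA
  have hsub : (unitFractionReps_finite 4 q).toFinset ⊆ A.biUnion fun a =>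
      (unitFractionReps_finite 3 (q - 1 / (a : ℚ))).toFinset.image
        (fun t : Fin 3 → ℕ => (Fin.cons a t : Fin 4 → ℕ)) := by
    intro a ha
    obtain ⟨hpos, hmono, hsum⟩ := (Set.Finite.mem_toFinset _).mp ha
    have h0 : ∀ i, (0 : ℚ) < a i := fun i => by exact_mod_cast hpos i
    have hle : ∀ i, 1 / (a i : ℚ) ≤ 1 / (a 0 : ℚ) := fun i =>
      one_div_le_one_div_of_le (h0 0) (by exact_mod_cast hmono (Fin.zero_le i))
    have hp : ∀ i, 0 < 1 / (a i : ℚ) := fun i => one_div_pos.mpr (h0 i)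
    have hsum' := hsum
    rw [Fin.sum_univ_four] at hsum'
    have hmul : (m : ℚ) * a 0 = n * (q * a 0) := by rw [← hmn]; ring
    have hlow : 1 < q * a 0 := by
      rw [← div_lt_iff₀ (h0 0), hsum']; linarith [hp 1, hp 2, hp 3]
    have hup : q * a 0 ≤ 4 := by
      rw [← le_div_iff₀ (h0 0), hsum']
      calc _ ≤ 4 * (1 / (a 0 : ℚ)) := by linarith [hle 1, hle 2, hle 3]
        _ = _ := by ring
    have hA1 : n < m * a 0 := by
      have : (n : ℚ) < m * a 0 := by rw [hmul]; nlinarith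
      exact_mod_cast this
    have hA2 : m * a 0 ≤ 4 * n := by
      have : (m : ℚ) * a 0 ≤ 4 * n := by rw [hmul]; nlinarith
      exact_mod_cast this
    have hm0 : 0 < m := Nat.pos_of_ne_zero (by rintro rfl; omega)
    have hA3 : a 0 < 4 * n + 1 := by
      have := Nat.le_mul_of_pos_left (a 0) hm0
      omega
    refine Finset.mem_biUnion.mpr ⟨a 0, Finset.mem_filter.mpr
      ⟨Finset.mem_range.mpr hA3, hA1, hA2⟩, Finset.mem_image.mpr ⟨Fin.tail a, ?_,
        Fin.cons_self_tail a⟩⟩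
    refine (Set.Finite.mem_toFinset _).mpr ⟨fun i => hpos _, fun i j hij =>
      hmono (Fin.succ_le_succ_iff.mpr hij), ?_⟩
    rw [hsum, Fin.sum_univ_succ]
    simp [Fin.tail]
  rw [Set.ncard_eq_toFinset_card _ (unitFractionReps_finite 4 q)]
  refine (Finset.card_le_card hsub).trans (Finset.card_biUnion_le.trans ?_)
  refine Finset.sum_le_sum fun a _ => Finset.card_image_le.trans_eq ?_
  rw [Set.ncard_eq_toFinset_card _ (unitFractionReps_finite 3 _)]

/-- The fraction `m / n - 1 / a` in lowest terms. -/
theorem exists_num_den_sub_one_div {q : ℚ} {m a : ℕ} (hq : q.num = m) (ha : q.den < m * a) :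
    ∃ d e : ℕ, (q - 1 / (a : ℚ)).num = e ∧ 0 < e ∧ m * a = q.den + d * e ∧
      q.den * a = d * (q - 1 / (a : ℚ)).den := by
  set n := q.den with hn
  have hn0 : 0 < n := q.den_pos
  have ha0 : 0 < a := Nat.pos_of_ne_zero (by rintro rfl; simp at ha)
  have hnQ : (n : ℚ) ≠ 0 := by exact_mod_cast hn0.ne'
  have haQ : (a : ℚ) ≠ 0 := by exact_mod_cast ha0.ne'
  have hmn : q * n = m := by
    rw [hn, Rat.mul_den_eq_num, hq, Int.cast_natCast]
  have hd0 : ((n * a : ℕ) : ℤ) ≠ 0 := by exact_mod_cast (Nat.mul_pos hn0 ha0).ne'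
  obtain ⟨c, h1, h2⟩ := Rat.exists_eq_mul_div_num_and_eq_mul_div_den ((m * a : ℤ) - n) hd0
  have hq' : (((m * a : ℤ) - n : ℤ) : ℚ) / ((n * a : ℕ) : ℤ) = q - 1 / (a : ℚ) := by
    push_cast
    rw [← hmn]
    field_simp
  rw [hq'] at h1 h2
  have hden : (0 : ℤ) < (q - 1 / (a : ℚ)).den := by exact_mod_cast Rat.den_pos _
  have hc : 0 < c := by
    have : (0 : ℤ) < ((n * a : ℕ) : ℤ) := by exact_mod_cast Nat.mul_pos hn0 ha0
    rw [h2] at this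
    exact pos_of_mul_pos_left this hden.le
  have hnum : 0 < (q - 1 / (a : ℚ)).num := by
    have : (0 : ℤ) < (m * a : ℤ) - n := by
      have : (n : ℤ) < m * a := by exact_mod_cast ha
      linarith
    rw [h1] at this
    exact pos_of_mul_pos_right this hc.le
  obtain ⟨d, rfl⟩ := Int.eq_ofNat_of_zero_le hc.le
  obtain ⟨e, he⟩ := Int.eq_ofNat_of_zero_le hnum.le
  refine ⟨d, e, he, by omega, ?_, by exact_mod_cast h2⟩
  rw [he] at h1
  have : (m * a : ℤ) = n + d * e := by linarith
  exact_mod_cast this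

/-- The sum over `a` of the `-4/5`-th powers of the numerators of `m / n - 1 / a`. -/
theorem sum_num_rpow_le {q : ℚ} {m : ℕ} (hm : 0 < m) (hq : q.num = m) :
    ∑ a ∈ (Finset.range (4 * q.den + 1)).filter (fun a => q.den < m * a ∧ m * a ≤ 4 * q.den),
        ((q - 1 / (a : ℚ)).num : ℝ) ^ (-(4 / 5) : ℝ) ≤
      ((q.den ^ 2).divisors.card : ℝ) *
        (1 + (m : ℝ) ^ (-(4 / 5) : ℝ) * (5 * ((4 * q.den / m : ℕ) : ℝ) ^ (1 / 5 : ℝ))) := by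
  classical
  set n := q.den with hn
  have hn0 : 0 < n := q.den_pos
  have hcop : Nat.Coprime n m := by
    have := q.reduced
    rw [hq, Int.natAbs_natCast] at this
    exact this.symm
  have hmR : (0 : ℝ) < m := by exact_mod_cast hm
  set A := (Finset.range (4 * n + 1)).filter (fun a => n < m * a ∧ m * a ≤ 4 * n) with hA
  have hex : ∀ a ∈ A, _ := fun a ha =>
    exists_num_den_sub_one_div hq (Finset.mem_filter.mp ha).2.1
  choose! d e he he0 hde hden using hex
  -- Writing j for the quotient of e by m, e ≥ mj bounds the term when j > 0; for j = 0 only e ≥ 1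
  -- is available.
  set w : ℕ → ℝ := fun j => if j = 0 then 1 else ((m : ℝ) * j) ^ (-(4 / 5) : ℝ) with hw
  have hw0 : ∀ j, 0 ≤ w j := by
    intro j
    rw [hw]; dsimp only
    split_ifs <;> positivity
  have hterm : ∀ a ∈ A, ((q - 1 / (a : ℚ)).num : ℝ) ^ (-(4 / 5) : ℝ) ≤ w (e a / m) := by
    intro a ha
    rw [he a ha, Int.cast_natCast, hw]
    dsimp only
    split_ifs with h
    · exact Real.rpow_le_one_of_one_le_of_nonpos (by exact_mod_cast he0 a ha) (by norm_num)
    · have h1 : ((m : ℝ) * ((e a / m : ℕ) : ℝ)) ≤ e a := by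
        exact_mod_cast Nat.mul_div_le (e a) m
      have h2 : (0 : ℝ) < ((e a / m : ℕ) : ℝ) := by exact_mod_cast Nat.pos_of_ne_zero h
      exact Real.rpow_le_rpow_of_nonpos (by positivity) h1 (by norm_num)
  -- A common divisor of m and d divides n, hence is 1. So d e ≡ -n modulo m fixes e modulo m, and
  -- the quotient recovers e, then a.
  have hinj : Set.InjOn (fun a => (d a, e a / m)) A := by
    intro a ha b hb hab
    simp only [Prod.mk.injEq] at hab
    obtain ⟨h1, h2⟩ := hab
    have ea := hde a ha
    have eb := hde b hb
    rw [← h1] at eb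
    have hdm : Nat.Coprime m (d a) := by
      have hg : Nat.gcd m (d a) ∣ n := by
        have : Nat.gcd m (d a) ∣ n + d a * e a := by
          rw [← ea]; exact (Nat.gcd_dvd_left _ _).mul_right _
        exact (Nat.dvd_add_left ((Nat.gcd_dvd_right _ _).mul_right _)).mp this
      exact Nat.eq_one_of_dvd_one (hcop ▸ Nat.dvd_gcd hg (Nat.gcd_dvd_left _ _))
    have hmod : e a ≡ e b [MOD m] := by
      refine Nat.ModEq.cancel_left_of_coprime hdm (Nat.ModEq.add_left_cancel' n ?_)
      rw [← ea, ← eb]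
      exact (Nat.modEq_zero_iff_dvd.mpr (Dvd.intro _ rfl)).trans
        (Nat.modEq_zero_iff_dvd.mpr (Dvd.intro _ rfl)).symm
    have hee : e a = e b := by
      rw [← Nat.div_add_mod (e a) m, ← Nat.div_add_mod (e b) m, h2, hmod]
    rw [hee, ← eb] at ea
    exact Nat.eq_of_mul_eq_mul_left hm ea
  have himg : A.image (fun a => (d a, e a / m)) ⊆
      (n ^ 2).divisors ×ˢ Finset.range (4 * n / m + 1) := by
    intro x hx
    obtain ⟨a, ha, rfl⟩ := Finset.mem_image.mp hx
    refine Finset.mem_product.mpr ⟨Nat.mem_divisors.mpr ⟨?_, (pow_pos hn0 2).ne'⟩,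
      Finset.mem_range.mpr (Nat.lt_succ_of_le (Nat.div_le_div_right ?_))⟩
    -- d divides both n a and m a - n, hence n² = m (n a) - n (m a - n).
    · have h1 : n ^ 2 + d a * (n * e a) = d a * (m * (q - 1 / (a : ℚ)).den) := by
        calc n ^ 2 + d a * (n * e a) = n * (n + d a * e a) := by ring
          _ = m * (n * a) := by rw [← hde a ha]; ring
          _ = _ := by rw [hden a ha]; ring
      exact (Nat.dvd_add_left (Dvd.intro _ rfl)).mp (h1 ▸ Dvd.intro _ rfl)
    · have h1 := (Finset.mem_filter.mp ha).2.2
      have h2 := hde a ha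
      have h3 : 0 < d a := Nat.pos_of_ne_zero fun h0 => by
        have := (Finset.mem_filter.mp ha).2.1
        rw [h0] at h2; omega
      have := Nat.le_mul_of_pos_left (e a) h3
      omega
  have hsumw : ∑ j ∈ Finset.range (4 * n / m + 1), w j ≤
      1 + (m : ℝ) ^ (-(4 / 5) : ℝ) * (5 * ((4 * n / m : ℕ) : ℝ) ^ (1 / 5 : ℝ)) := by
    rw [Finset.sum_range_succ', add_comm]
    have h1 : w 0 = 1 := by simp [hw]
    rw [h1]
    refine add_le_add le_rfl ?_
    refine le_trans (le_of_eq ?_)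
      (mul_le_mul_of_nonneg_left (sum_range_rpow_neg_le (4 * n / m)) (by positivity))
    rw [Finset.mul_sum]
    refine Finset.sum_congr rfl fun j _ => ?_
    rw [hw]; dsimp only
    rw [if_neg (Nat.succ_ne_zero j), Real.mul_rpow hmR.le (by positivity)]
    push_cast; rfl
  calc _ ≤ ∑ a ∈ A, w (e a / m) := Finset.sum_le_sum hterm
    _ = ∑ x ∈ A.image (fun a => (d a, e a / m)), w x.2 := by
        rw [Finset.sum_image hinj]
    _ ≤ ∑ x ∈ (n ^ 2).divisors ×ˢ Finset.range (4 * n / m + 1), w x.2 :=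
        Finset.sum_le_sum_of_subset_of_nonneg himg fun x _ _ => hw0 _
    _ = ((n ^ 2).divisors.card : ℝ) * ∑ j ∈ Finset.range (4 * n / m + 1), w j := by
        rw [Finset.sum_product]; simp
    _ ≤ _ := by gcongr

/-- The number of representations as a sum of four unit fractions. -/
theorem exists_ncard_unitFractionReps_four_le {ε : ℝ} (hε : 0 < ε) :
    ∃ C : ℝ, 1 ≤ C ∧ ∀ q : ℚ, 0 < q → ((unitFractionReps 4 q).ncard : ℝ) ≤
      C * (q.den : ℝ) ^ ε * ((q.den : ℝ) ^ (7 / 5 : ℝ) * (q.num : ℝ) ^ (-(7 / 5) : ℝ) +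
        (q.den : ℝ) ^ (6 / 5 : ℝ) * (q.num : ℝ) ^ (-(3 / 5) : ℝ)) := by
  obtain ⟨C₁, hC₁, hdiv⟩ := exists_card_divisors_le_rpow (δ := ε / 4) (by positivity)
  obtain ⟨C₃, hC₃, hthree⟩ := exists_ncard_unitFractionReps_three_le (ε := ε / 4) (by positivity)
  have h4 : (1 : ℝ) ≤ (4 : ℝ) ^ (ε / 4) := Real.one_le_rpow (by norm_num) (by positivity)
  refine ⟨C₃ * (4 : ℝ) ^ (ε / 4) * (96 * C₁), ?_, fun q hq => ?_⟩
  · have := one_le_mul_of_one_le_of_one_le hC₃ h4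
    exact one_le_mul_of_one_le_of_one_le this (by linarith)
  obtain ⟨m, hm⟩ := Int.eq_ofNat_of_zero_le (Rat.num_nonneg.mpr hq.le)
  have hm' : q.num = m := by simpa using hm
  have hm0 : 0 < m := by
    have := Rat.num_pos.mpr hq
    omega
  have hone := ncard_unitFractionReps_four_le hm'
  have htwo := sum_num_rpow_le hm0 hm'
  rw [hm', Int.cast_natCast]
  set n := q.den with hn
  have hn0 : 0 < n := q.den_pos
  set A := (Finset.range (4 * n + 1)).filter (fun a => n < m * a ∧ m * a ≤ 4 * n) with hA
  have hnR : (1 : ℝ) ≤ n := by exact_mod_cast hn0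
  have hnR0 : (0 : ℝ) < n := by linarith
  have hmR : (1 : ℝ) ≤ m := by exact_mod_cast hm0
  have hmR0 : (0 : ℝ) < m := by linarith
  -- Nonemptiness yields 4n/m ≥ 1, which is needed to raise 4n/m to a larger exponent.
  rcases A.eq_empty_or_nonempty with hAe | ⟨a₀, ha₀⟩
  · rw [hAe, Finset.sum_empty] at hone
    have : (unitFractionReps 4 q).ncard = 0 := by omega
    rw [this, Nat.cast_zero]
    positivity
  have hr1 : 1 ≤ 4 * (n : ℝ) / m := by
    rw [le_div_iff₀ hmR0, one_mul]
    obtain ⟨-, h1, h2⟩ := Finset.mem_filter.mp ha₀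
    have ha0 : 0 < a₀ := Nat.pos_of_ne_zero (by rintro rfl; simp at h1)
    have := Nat.le_mul_of_pos_right m ha0
    exact_mod_cast this.trans h2
  have hJ : ((4 * n / m : ℕ) : ℝ) ≤ 4 * (n : ℝ) / m := by
    have := Nat.cast_div_le (α := ℝ) (m := 4 * n) (n := m)
    push_cast at this
    exact this
  have hAcard : (A.card : ℝ) ≤ 4 * (n : ℝ) / m := by
    refine le_trans ?_ hJ
    norm_cast
    refine (Finset.card_le_card (t := Finset.Ioc 0 (4 * n / m)) fun a ha => ?_).trans_eq (by simp)
    obtain ⟨-, h1, h2⟩ := Finset.mem_filter.mp ha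
    refine Finset.mem_Ioc.mpr ⟨Nat.pos_of_ne_zero (by rintro rfl; simp at h1), ?_⟩
    rw [Nat.le_div_iff_mul_le hm0, mul_comm]
    exact h2
  set X := (n : ℝ) ^ (6 / 5 : ℝ) * (m : ℝ) ^ (-(3 / 5) : ℝ) with hX
  set Y := (n : ℝ) ^ (7 / 5 : ℝ) * (m : ℝ) ^ (-(7 / 5) : ℝ) with hY
  have hX0 : 0 ≤ X := by positivity
  have hY0 : 0 ≤ Y := by positivity
  have hden : ∀ a ∈ A, ((q - 1 / (a : ℚ)).den : ℝ) ≤ 4 * (n : ℝ) ^ 2 / m := by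
    intro a ha
    obtain ⟨-, h1, h2⟩ := Finset.mem_filter.mp ha
    obtain ⟨d, e, -, -, h3, h5⟩ := exists_num_den_sub_one_div hm' h1
    have hd : 0 < d := Nat.pos_of_ne_zero (by rintro rfl; omega)
    rw [le_div_iff₀ hmR0]
    have : (q - 1 / (a : ℚ)).den * m ≤ 4 * n ^ 2 := by
      calc (q - 1 / (a : ℚ)).den * m ≤ (d * (q - 1 / (a : ℚ)).den) * m := by
            gcongr; exact Nat.le_mul_of_pos_left _ hd
        _ = n * (m * a) := by rw [← h5]; ring
        _ ≤ n * (4 * n) := by gcongr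
        _ = _ := by ring
    exact_mod_cast this
  have hden1 : ∀ a ∈ A, ((q - 1 / (a : ℚ)).den : ℝ) ^ (ε / 4) ≤
      (4 : ℝ) ^ (ε / 4) * (n : ℝ) ^ (ε / 2) := by
    intro a ha
    calc ((q - 1 / (a : ℚ)).den : ℝ) ^ (ε / 4) ≤ (4 * (n : ℝ) ^ 2) ^ (ε / 4) := by
          have := (hden a ha).trans (div_le_self (by positivity) hmR)
          gcongr
      _ = _ := by
          rw [Real.mul_rpow (by norm_num) (by positivity), ← Real.rpow_natCast (n : ℝ) 2,
            ← Real.rpow_mul hnR0.le]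
          congr 2; push_cast; ring
  have hfour : ∀ s : ℝ, 0 ≤ s → s ≤ 1 → (4 : ℝ) ^ s ≤ 4 := fun s _ hs => by
    simpa using Real.rpow_le_rpow_of_exponent_le (x := 4) (by norm_num) hs
  have hden2 : ∀ a ∈ A, ((q - 1 / (a : ℚ)).den : ℝ) ^ (3 / 5 : ℝ) ≤ 4 * X := by
    intro a ha
    calc ((q - 1 / (a : ℚ)).den : ℝ) ^ (3 / 5 : ℝ) ≤ (4 * (n : ℝ) ^ 2 / m) ^ (3 / 5 : ℝ) := by
          have := hden a ha
          gcongr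
      _ = (4 : ℝ) ^ (3 / 5 : ℝ) * X := by
          rw [Real.div_rpow (by positivity) hmR0.le, Real.mul_rpow (by norm_num) (by positivity),
            ← Real.rpow_natCast (n : ℝ) 2, ← Real.rpow_mul hnR0.le, div_eq_mul_inv,
            ← Real.rpow_neg hmR0.le, hX]
          norm_num
          ring
      _ ≤ 4 * X := by gcongr; exact hfour _ (by norm_num) (by norm_num)
  -- The term 1 of the three-fraction bound, summed over a, is absorbed here.
  have hAY : (A.card : ℝ) ≤ 16 * Y := by
    calc (A.card : ℝ) ≤ 4 * (n : ℝ) / m := hAcard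
      _ = (4 * (n : ℝ) / m) ^ (1 : ℝ) := (Real.rpow_one _).symm
      _ ≤ (4 * (n : ℝ) / m) ^ (7 / 5 : ℝ) := Real.rpow_le_rpow_of_exponent_le hr1 (by norm_num)
      _ = (4 : ℝ) ^ (7 / 5 : ℝ) * Y := by
          rw [Real.div_rpow (by positivity) hmR0.le, Real.mul_rpow (by norm_num) hnR0.le,
            div_eq_mul_inv, ← Real.rpow_neg hmR0.le, hY, mul_assoc]
      _ ≤ 16 * Y := by
          gcongr
          have : (4 : ℝ) ^ (7 / 5 : ℝ) ≤ (4 : ℝ) ^ (2 : ℝ) :=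
            Real.rpow_le_rpow_of_exponent_le (by norm_num) (by norm_num)
          refine this.trans (by norm_num)
  have hτ : ((n ^ 2).divisors.card : ℝ) ≤ C₁ * (n : ℝ) ^ (ε / 2) := by
    refine (hdiv _ (pow_pos hn0 2).ne').trans_eq ?_
    rw [Nat.cast_pow, ← Real.rpow_natCast (n : ℝ) 2, ← Real.rpow_mul hnR0.le]
    congr 2; push_cast; ring
  have hXY : X * ((m : ℝ) ^ (-(4 / 5) : ℝ) * (5 * ((4 * n / m : ℕ) : ℝ) ^ (1 / 5 : ℝ))) ≤
      20 * Y := by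
    have h1 : ((4 * n / m : ℕ) : ℝ) ^ (1 / 5 : ℝ) ≤
        4 * ((n : ℝ) ^ (1 / 5 : ℝ) * (m : ℝ) ^ (-(1 / 5) : ℝ)) := by
      calc ((4 * n / m : ℕ) : ℝ) ^ (1 / 5 : ℝ) ≤ (4 * (n : ℝ) / m) ^ (1 / 5 : ℝ) := by gcongr
        _ = (4 : ℝ) ^ (1 / 5 : ℝ) * ((n : ℝ) ^ (1 / 5 : ℝ) * (m : ℝ) ^ (-(1 / 5) : ℝ)) := by
          rw [Real.div_rpow (by positivity) hmR0.le, Real.mul_rpow (by norm_num) hnR0.le,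
            div_eq_mul_inv, ← Real.rpow_neg hmR0.le, mul_assoc]
        _ ≤ _ := by gcongr; exact hfour _ (by norm_num) (by norm_num)
    calc _ ≤ X * ((m : ℝ) ^ (-(4 / 5) : ℝ) *
          (5 * (4 * ((n : ℝ) ^ (1 / 5 : ℝ) * (m : ℝ) ^ (-(1 / 5) : ℝ))))) := by gcongr
      _ = 20 * (((n : ℝ) ^ (6 / 5 : ℝ) * (n : ℝ) ^ (1 / 5 : ℝ)) *
          ((m : ℝ) ^ (-(3 / 5) : ℝ) * (m : ℝ) ^ (-(4 / 5) : ℝ) * (m : ℝ) ^ (-(1 / 5) : ℝ))) := by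
          rw [hX]; ring
      _ = 20 * ((n : ℝ) ^ (7 / 5 : ℝ) * (m : ℝ) ^ (-(8 / 5) : ℝ)) := by
          rw [← Real.rpow_add hnR0, ← Real.rpow_add hmR0, ← Real.rpow_add hmR0]
          norm_num
      -- The exponent -8/5 is weakened to -7/5: `Y` must also absorb n/m, and it must not decrease
      -- when m and n are scaled by a common factor.
      _ ≤ 20 * Y := by
          rw [hY]
          gcongr
          norm_num
  have hnε : (n : ℝ) ^ ε = (n : ℝ) ^ (ε / 2) * (n : ℝ) ^ (ε / 2) := by
    rw [← Real.rpow_add hnR0]; congr 1; ring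
  have hnε1 : (1 : ℝ) ≤ (n : ℝ) ^ (ε / 2) := Real.one_le_rpow hnR (by positivity)
  have hterm : ∀ a ∈ A, ((unitFractionReps 3 (q - 1 / (a : ℚ))).ncard : ℝ) ≤
      C₃ * ((4 : ℝ) ^ (ε / 4) * (n : ℝ) ^ (ε / 2)) *
        (1 + 4 * X * ((q - 1 / (a : ℚ)).num : ℝ) ^ (-(4 / 5) : ℝ)) := by
    intro a ha
    obtain ⟨-, h1, -⟩ := Finset.mem_filter.mp ha
    obtain ⟨d, e, he, he0, -, -⟩ := exists_num_den_sub_one_div hm' h1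
    have hpos : 0 < q - 1 / (a : ℚ) := by
      rw [← Rat.num_pos, he]; exact_mod_cast he0
    refine (hthree _ hpos).trans ?_
    have hnum : (0 : ℝ) ≤ (q - 1 / (a : ℚ)).num := by rw [he]; positivity
    have d1 := hden1 a ha
    have d2 := hden2 a ha
    gcongr
  calc ((unitFractionReps 4 q).ncard : ℝ)
      ≤ ∑ a ∈ A, ((unitFractionReps 3 (q - 1 / (a : ℚ))).ncard : ℝ) := by exact_mod_cast hone
    _ ≤ ∑ a ∈ A, C₃ * ((4 : ℝ) ^ (ε / 4) * (n : ℝ) ^ (ε / 2)) *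
        (1 + 4 * X * ((q - 1 / (a : ℚ)).num : ℝ) ^ (-(4 / 5) : ℝ)) := Finset.sum_le_sum hterm
    _ = C₃ * ((4 : ℝ) ^ (ε / 4) * (n : ℝ) ^ (ε / 2)) * (A.card +
        4 * X * ∑ a ∈ A, ((q - 1 / (a : ℚ)).num : ℝ) ^ (-(4 / 5) : ℝ)) := by
        rw [← Finset.mul_sum, Finset.sum_add_distrib, ← Finset.mul_sum]; simp
    _ ≤ C₃ * ((4 : ℝ) ^ (ε / 4) * (n : ℝ) ^ (ε / 2)) * (16 * Y +
        4 * X * (C₁ * (n : ℝ) ^ (ε / 2) *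
          (1 + (m : ℝ) ^ (-(4 / 5) : ℝ) * (5 * ((4 * n / m : ℕ) : ℝ) ^ (1 / 5 : ℝ))))) := by
        have := htwo.trans (mul_le_mul_of_nonneg_right hτ (by positivity))
        gcongr
    _ = C₃ * ((4 : ℝ) ^ (ε / 4) * (n : ℝ) ^ (ε / 2)) * (16 * Y +
        4 * (C₁ * (n : ℝ) ^ (ε / 2)) * (X +
          X * ((m : ℝ) ^ (-(4 / 5) : ℝ) * (5 * ((4 * n / m : ℕ) : ℝ) ^ (1 / 5 : ℝ))))) := by ring
    _ ≤ C₃ * ((4 : ℝ) ^ (ε / 4) * (n : ℝ) ^ (ε / 2)) * (16 * (C₁ * (n : ℝ) ^ (ε / 2)) * Y +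
        4 * (C₁ * (n : ℝ) ^ (ε / 2)) * (X + 20 * Y)) := by
        have h1 : (1 : ℝ) ≤ C₁ * (n : ℝ) ^ (ε / 2) := one_le_mul_of_one_le_of_one_le hC₁ hnε1
        have h2 : 16 * Y ≤ 16 * (C₁ * (n : ℝ) ^ (ε / 2)) * Y := by nlinarith
        gcongr
    -- 96 = 16 + 4 · 20.
    _ ≤ C₃ * ((4 : ℝ) ^ (ε / 4) * (n : ℝ) ^ (ε / 2)) *
        (96 * (C₁ * (n : ℝ) ^ (ε / 2)) * (Y + X)) := by
        have : 0 ≤ C₁ * (n : ℝ) ^ (ε / 2) * X := by positivity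
        gcongr
        linarith
    _ = _ := by rw [hnε]; ring

/-! ### Comparison of exponents and the five ranges. -/

/-- Comparison of monomials in `n` and `m` under an upper bound for `m`. -/
theorem rpow_mul_rpow_le_of_le {n m K θ a b a' b' : ℝ} (hn : 1 ≤ n) (hm : 1 ≤ m) (hK : 0 < K)
    (h : m ≤ K * n ^ θ) (h₀ : b' ≤ b) (h₂ : b ≤ b' + 2) (hle : a + θ * (b - b') ≤ a') :
    n ^ a * m ^ b ≤ max 1 K ^ (2 : ℝ) * (n ^ a' * m ^ b') := by
  have hn0 : 0 < n := by linarith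
  have hm0 : 0 < m := by linarith
  -- The gap b - b' is at most 2, so one power of `max 1 K` serves every comparison.
  have h1 : m ^ (b - b') ≤ max 1 K ^ (2 : ℝ) * n ^ (θ * (b - b')) := by
    calc m ^ (b - b') ≤ (K * n ^ θ) ^ (b - b') :=
          Real.rpow_le_rpow hm0.le h (by linarith)
      _ = K ^ (b - b') * n ^ (θ * (b - b')) := by
          rw [Real.mul_rpow hK.le (by positivity), ← Real.rpow_mul hn0.le]
      _ ≤ max 1 K ^ (b - b') * n ^ (θ * (b - b')) := by
          refine mul_le_mul_of_nonneg_right ?_ (by positivity)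
          exact Real.rpow_le_rpow hK.le (le_max_right _ _) (by linarith)
      _ ≤ _ := by
          gcongr
          · exact le_max_left _ _
          · linarith
  calc n ^ a * m ^ b = n ^ a * m ^ (b - b') * m ^ b' := by
        rw [mul_assoc, ← Real.rpow_add hm0]; ring_nf
    _ ≤ n ^ a * (max 1 K ^ (2 : ℝ) * n ^ (θ * (b - b'))) * m ^ b' := by gcongr
    _ = max 1 K ^ (2 : ℝ) * (n ^ (a + θ * (b - b')) * m ^ b') := by
        rw [Real.rpow_add hn0]; ring
    _ ≤ _ := by gcongr

/-- Comparison of monomials in `n` and `m` under a lower bound for `m`. -/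
theorem rpow_mul_rpow_le_of_ge {n m K θ a b a' b' : ℝ} (hn : 1 ≤ n) (hm : 1 ≤ m) (hK : 0 < K)
    (h : n ^ θ ≤ K * m) (h₀ : b ≤ b') (h₂ : b' ≤ b + 2) (hle : a ≤ a' + θ * (b' - b)) :
    n ^ a * m ^ b ≤ max 1 K ^ (2 : ℝ) * (n ^ a' * m ^ b') := by
  have hn0 : 0 < n := by linarith
  have hm0 : 0 < m := by linarith
  have h1 : n ^ (θ * (b' - b)) ≤ max 1 K ^ (2 : ℝ) * m ^ (b' - b) := by
    calc n ^ (θ * (b' - b)) = (n ^ θ) ^ (b' - b) := Real.rpow_mul hn0.le _ _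
      _ ≤ (K * m) ^ (b' - b) := Real.rpow_le_rpow (by positivity) h (by linarith)
      _ = K ^ (b' - b) * m ^ (b' - b) := Real.mul_rpow hK.le hm0.le
      _ ≤ max 1 K ^ (b' - b) * m ^ (b' - b) := by
          refine mul_le_mul_of_nonneg_right ?_ (by positivity)
          exact Real.rpow_le_rpow hK.le (le_max_right _ _) (by linarith)
      _ ≤ _ := by
          gcongr
          · exact le_max_left _ _
          · linarith
  calc n ^ a * m ^ b ≤ n ^ (a' + θ * (b' - b)) * m ^ b := by gcongr
    _ = n ^ a' * n ^ (θ * (b' - b)) * m ^ b := by rw [Real.rpow_add hn0]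
    _ ≤ n ^ a' * (max 1 K ^ (2 : ℝ) * m ^ (b' - b)) * m ^ b := by gcongr
    _ = max 1 K ^ (2 : ℝ) * (n ^ a' * (m ^ (b' - b) * m ^ b)) := by ring
    _ = _ := by rw [← Real.rpow_add hm0, sub_add_cancel]

/-- The bound from which the five ranges are read off. -/
theorem exists_unitFractionCount_four_le {ε : ℝ} (hε : 0 < ε) :
    ∃ C : ℝ, 1 ≤ C ∧ ∀ m n : ℕ, 0 < m → 0 < n → (unitFractionCount 4 m n : ℝ) ≤
      C * (n : ℝ) ^ ε * ((n : ℝ) ^ (7 / 5 : ℝ) * (m : ℝ) ^ (-(7 / 5) : ℝ) +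
        (n : ℝ) ^ (6 / 5 : ℝ) * (m : ℝ) ^ (-(3 / 5) : ℝ)) := by
  obtain ⟨C, hC, h⟩ := exists_ncard_unitFractionReps_four_le hε
  refine ⟨C, hC, fun m n hm hn => ?_⟩
  have hmQ : (0 : ℚ) < m := by exact_mod_cast hm
  have hnQ : (0 : ℚ) < n := by exact_mod_cast hn
  have hq : (0 : ℚ) < (m : ℚ) / n := div_pos hmQ hnQ
  refine (h _ hq).trans ?_
  obtain ⟨c, h1, h2⟩ := Rat.exists_eq_mul_div_num_and_eq_mul_div_den (m : ℤ)
    (d := (n : ℤ)) (by exact_mod_cast hn.ne')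
  simp only [Int.cast_natCast] at h1 h2
  set q : ℚ := (m : ℚ) / n with hqdef
  have hden : (0 : ℤ) < q.den := by exact_mod_cast q.den_pos
  have hnum : 0 < q.num := Rat.num_pos.mpr hq
  have hc : 0 < c := by
    have h3 : (0 : ℤ) < n := by exact_mod_cast hn
    rw [h2] at h3
    exact pos_of_mul_pos_left h3 hden.le
  have hcR : (1 : ℝ) ≤ c := by exact_mod_cast hc
  have hcR0 : (0 : ℝ) < c := by linarith
  have e1 : (m : ℝ) = c * q.num := by exact_mod_cast h1
  have e2 : (n : ℝ) = c * q.den := by exact_mod_cast h2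
  have hN : (0 : ℝ) < q.den := by exact_mod_cast hden
  have hM : (0 : ℝ) < q.num := by exact_mod_cast hnum
  rw [e1, e2]
  set M : ℝ := (q.num : ℝ)
  set N : ℝ := (q.den : ℝ)
  have k1 : N ^ ε ≤ (c * N) ^ ε := by
    gcongr
    exact le_mul_of_one_le_left hN.le hcR
  -- For m/n not in lowest terms the common factor c contributes c^{a+b}, harmless because both
  -- monomials have a + b ≥ 0.
  have scale : ∀ a b : ℝ, (c * N : ℝ) ^ a * (c * M) ^ b = (c : ℝ) ^ (a + b) * (N ^ a * M ^ b) := by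
    intro a b
    rw [Real.mul_rpow hcR0.le hN.le, Real.mul_rpow hcR0.le hM.le, Real.rpow_add hcR0]
    ring
  have k2 : ∀ a b : ℝ, 0 ≤ a + b → N ^ a * M ^ b ≤ (c * N : ℝ) ^ a * (c * M) ^ b := by
    intro a b hab
    rw [scale]
    exact le_mul_of_one_le_left (by positivity) (Real.one_le_rpow hcR hab)
  have k3 := k2 (7 / 5) (-(7 / 5)) (by norm_num)
  have k4 := k2 (6 / 5) (-(3 / 5)) (by norm_num)
  gcongr

/-- `K` is the constant implied in the symbols `≪` that delimit the five ranges; the constant `C`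
of the bounds depends on `ε` and `K` only. -/
theorem mainTheorem4 :
    ∀ ε : ℝ, 0 < ε → ∀ K : ℝ, 0 < K → ∃ C : ℝ, 0 < C ∧
      ∀ m n : ℕ, 0 < m → 0 < n →
        ((m : ℝ) ≤ K * (n : ℝ) ^ (50 / 289 : ℝ) →
          (unitFractionCount 4 m n : ℝ) ≤
            C * ((n : ℝ) ^ ε * ((n : ℝ) ^ (3 / 2 : ℝ) / (m : ℝ) ^ (3 / 4 : ℝ)))) ∧
        ((n : ℝ) ^ (50 / 289 : ℝ) ≤ K * (m : ℝ) → (m : ℝ) ≤ K * (n : ℝ) ^ (5 / 17 : ℝ) →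
          (unitFractionCount 4 m n : ℝ) ≤
            C * ((n : ℝ) ^ ε * ((n : ℝ) ^ (28 / 17 : ℝ) / (m : ℝ) ^ (8 / 5 : ℝ)))) ∧
        ((n : ℝ) ^ (5 / 17 : ℝ) ≤ K * (m : ℝ) → (m : ℝ) ≤ K * (n : ℝ) ^ (1 / 3 : ℝ) →
          (unitFractionCount 4 m n : ℝ) ≤
            C * ((n : ℝ) ^ ε * ((n : ℝ) / (m : ℝ)) ^ (5 / 3 : ℝ))) ∧
        ((n : ℝ) ^ (1 / 3 : ℝ) ≤ K * (m : ℝ) → (m : ℝ) ≤ K * (n : ℝ) ^ (4 / 5 : ℝ) →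
          (unitFractionCount 4 m n : ℝ) ≤
            C * ((n : ℝ) ^ ε * ((n : ℝ) ^ (4 / 3 : ℝ) / (m : ℝ) ^ (2 / 3 : ℝ)))) ∧
        ((n : ℝ) ^ (4 / 5 : ℝ) ≤ K * (m : ℝ) → (m : ℝ) ≤ K * (n : ℝ) →
          (unitFractionCount 4 m n : ℝ) ≤
            C * ((n : ℝ) ^ ε * ((n : ℝ) ^ (8 / 5 : ℝ) / (m : ℝ)))) := by
  intro ε hε K hK
  obtain ⟨C, hC, h⟩ := exists_unitFractionCount_four_le hε
  set B : ℝ := max 1 K ^ (2 : ℝ) with hB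
  have hB0 : 0 < B := by positivity
  refine ⟨2 * B * C, by positivity, fun m n hm hn => ?_⟩
  have hmR : (1 : ℝ) ≤ m := by exact_mod_cast hm
  have hnR : (1 : ℝ) ≤ n := by exact_mod_cast hn
  have hmR0 : (0 : ℝ) ≤ m := by linarith
  have hnR0 : (0 : ℝ) ≤ n := by linarith
  have reduce : ∀ a b : ℝ,
      (n : ℝ) ^ (7 / 5 : ℝ) * (m : ℝ) ^ (-(7 / 5) : ℝ) ≤ B * ((n : ℝ) ^ a * (m : ℝ) ^ (-b)) →
      (n : ℝ) ^ (6 / 5 : ℝ) * (m : ℝ) ^ (-(3 / 5) : ℝ) ≤ B * ((n : ℝ) ^ a * (m : ℝ) ^ (-b)) →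
      (unitFractionCount 4 m n : ℝ) ≤
        2 * B * C * ((n : ℝ) ^ ε * ((n : ℝ) ^ a / (m : ℝ) ^ b)) := by
    intro a b h1 h2
    rw [div_eq_mul_inv, ← Real.rpow_neg hmR0]
    calc (unitFractionCount 4 m n : ℝ) ≤ _ := h m n hm hn
      _ ≤ C * (n : ℝ) ^ ε * (B * ((n : ℝ) ^ a * (m : ℝ) ^ (-b)) +
            B * ((n : ℝ) ^ a * (m : ℝ) ^ (-b))) := by gcongr
      _ = _ := by ring
  -- No range condition is needed here: m ≥ 1 alone suffices, which is the case θ = 0, K = 1.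
  have hmain1 : (n : ℝ) ^ (7 / 5 : ℝ) * (m : ℝ) ^ (-(7 / 5) : ℝ) ≤
      B * ((n : ℝ) ^ (3 / 2 : ℝ) * (m : ℝ) ^ (-(3 / 4) : ℝ)) := by
    have hmax : (max 1 1 : ℝ) ^ (2 : ℝ) ≤ B := by
      rw [hB, max_self, Real.one_rpow]
      exact Real.one_le_rpow (le_max_left _ _) (by norm_num)
    refine (rpow_mul_rpow_le_of_ge (K := 1) (θ := 0) (a' := 3 / 2) (b' := -(3 / 4)) hnR hmR one_pos
      (by simpa using hmR) (by norm_num) (by norm_num) (by norm_num)).trans ?_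
    gcongr
  refine ⟨fun hu => ?_, fun hl hu => ?_, fun hl hu => ?_, fun hl hu => ?_, fun hl hu => ?_⟩
  · exact reduce _ _ hmain1
      (rpow_mul_rpow_le_of_le hnR hmR hK hu (by norm_num) (by norm_num) (by norm_num))
  · exact reduce _ _
      (rpow_mul_rpow_le_of_le hnR hmR hK hu (by norm_num) (by norm_num) (by norm_num))
      (rpow_mul_rpow_le_of_le hnR hmR hK hu (by norm_num) (by norm_num) (by norm_num))
  · rw [Real.div_rpow hnR0 hmR0]
    exact reduce _ _
      (rpow_mul_rpow_le_of_le hnR hmR hK hu (by norm_num) (by norm_num) (by norm_num))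
      (rpow_mul_rpow_le_of_le hnR hmR hK hu (by norm_num) (by norm_num) (by norm_num))
  · exact reduce _ _
      (rpow_mul_rpow_le_of_ge hnR hmR hK hl (by norm_num) (by norm_num) (by norm_num))
      (rpow_mul_rpow_le_of_le hnR hmR hK hu (by norm_num) (by norm_num) (by norm_num))
  · have hu' : (m : ℝ) ≤ K * (n : ℝ) ^ (1 : ℝ) := by rwa [Real.rpow_one]
    have := reduce (8 / 5) 1
      (rpow_mul_rpow_le_of_ge hnR hmR hK hl (by norm_num) (by norm_num) (by norm_num))
      -- The tight case: with θ = 1 the exponents satisfy 6/5 + 2/5 = 8/5 exactly.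
      (rpow_mul_rpow_le_of_le hnR hmR hK hu' (by norm_num) (by norm_num) (by norm_num))
    rwa [Real.rpow_one] at this
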